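/- Let $k$ be an algebraically closed field of characteristic $p>0$, let $K_0=\operatorname{Frac}(W(k))$ be the fraction field of the ring of Witt vectors of $k$, fix an algebraic closure of $K_0$, and put $K_n=K_0(\zeta_{p^n})$, where $\zeta_{p^n}$ is a primitive $p^n$-th root of unity. Every finite extension $F$ of $K_0$ carries its discrete valuation $v_F$, normalized so that a uniformizer has valuation $1$; write $v_n=v_{K_n}$ and $e_F=v_F(p)$. For a finite Galois extension $M/F$ of finite extensions of $K_0$ with group $G$, and a uniformizer $\pi_M$ of $M$, let $G_i=\{g\in G: v_M(g\pi_M-\pi_M)\ge i+1\}$ for real $i\ge 0$, let $\phi_{M/F}(u)=\int_0^u \frac{dx}{[G_0:G_x]}$ for $u\ge 0$, let $\psi_{M/F}$ be the inverse of $\phi_{M/F}$ on $[0,\infty)$, and let $G^i=G_{\psi_{M/F}(i)}$. The conductor of $M/F$ is $h_{M/F}=\sup\{i\in[0,\infty): G^i\ne\{\mathrm{id}\}\}$ (with $h_{M/F}=0$ if $M=F$). For $F$ a finite extension of $K_1$, an element $a=1+t\in F^\times$ is called $p$-primitive for $F$ if either $p\nmid v_F(a)$, or $0<v_F(t)<\frac{p}{p-1}e_F$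 and $p\nmid v_F(t)$. Let $\ell\ge 1$ and $c\ge 1$ be integers, and let $a=1+t\in K_\ell$ be $p$-primitive for $K_\ell$ with $v_\ell(a)\ge 0$. Put $K=K_{\max(\ell,c)}(\sqrt[p^c]{a})$, for any choice of the $p^c$-th root. Then $K$ is Galois over $K_\ell$. Let $L$ be the Galois closure of $K$ over $K_0$. Then: (i) $h_{K/K_\ell}=(c(p-1)+1)\,p^{\ell-1}-v_\ell(t)$; (ii) $h_{L/K_0}=\max\left(\ell-1,\; c+\ell-1-\dfrac{v_\ell(t)-1}{p^{\ell-1}(p-1)}\right)$. -/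

import Mathlib

noncomputable section

namespace RamificationConductor

section General

/- Here `A` is the valuation ring of a complete discrete valuation field and `L` is a finite
extension of that field.  The valuation ring of `L` is the integral closure of `A` in `L`. -/
variable (A : Type*) [CommRing A] (L : Type*) [Field L] [Algebra A L]

/-- `ϖ` is a uniformizer of `L`, i.e. an irreducible element of the valuation ring of `L`. -/
def IsUniformizer (ϖ : L) : Prop :=
  ∃ x : integralClosure A L, Irreducible x ∧ (x : L) = ϖ

/-- `x = u ϖ ^ n` for a uniformizer `ϖ` of `L` and a unit `u` of the valuation ring of `L`. -/
def HasOrd (x : L) (n : ℤ) : Prop :=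
  ∃ ϖ : L, IsUniformizer A L ϖ ∧ ∃ u : (integralClosure A L)ˣ,
    x = ((u : integralClosure A L) : L) * ϖ ^ n

open Classical in
/-- The valuation `v_L` of `L`, normalized so that uniformizers have valuation `1`;
the value at `0` is `⊤`. -/
def ord (x : L) : WithTop ℤ :=
  if h : ∃ n : ℤ, HasOrd A L x n then ((h.choose : ℤ) : WithTop ℤ) else ⊤

/-- `a = 1 + t` is `p`-primitive for `L` if either `p ∤ v_L(a)`, or
`0 < v_L(t) < (p / (p - 1)) e_L` and `p ∤ v_L(t)`, where `e_L = v_L(p)`. -/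
def IsPPrimitive (p : ℕ) (a : L) : Prop :=
  (∃ m : ℤ, ord A L a = m ∧ ¬ (p : ℤ) ∣ m) ∨
    ∃ n e : ℤ, ord A L (a - 1) = n ∧ ord A L (p : L) = e ∧
      0 < n ∧ (n : ℝ) < (p : ℝ) / ((p : ℝ) - 1) * (e : ℝ) ∧ ¬ (p : ℤ) ∣ n

variable (K : Type*) [Field K] [Algebra K L]

/-- The lower numbering ramification group `G_i`, `i ≥ 0` real, of a Galois extension `L / K`:
`g ∈ G_i` iff `v_L(g π - π) ≥ i + 1` for a uniformizer `π` of `L`. -/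
def lowerGroup (i : ℝ) : Set (L ≃ₐ[K] L) :=
  {g | ∀ π : L, IsUniformizer A L π →
    ((i + 1 : ℝ) : WithTop ℝ) ≤ (ord A L (g π - π)).map (fun n : ℤ => (n : ℝ))}

/-- The Herbrand function `φ_{L/K}(u) = ∫_0^u dt / [G_0 : G_t]`. -/
def herbrandPhi (u : ℝ) : ℝ :=
  ∫ t in (0 : ℝ)..u, ((lowerGroup A L K t).ncard : ℝ) / ((lowerGroup A L K 0).ncard : ℝ)

/-- `ψ_{L/K} : [0, ∞) → [0, ∞)`, the inverse of `φ_{L/K}`. -/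
def herbrandPsi (v : ℝ) : ℝ :=
  Function.invFunOn (herbrandPhi A L K) (Set.Ici 0) v

/-- The upper numbering ramification group `G^i = G_{ψ_{L/K}(i)}`. -/
def upperGroup (i : ℝ) : Set (L ≃ₐ[K] L) :=
  lowerGroup A L K (herbrandPsi A L K i)

/-- The conductor `h_{L/K} = sup {i ≥ 0 | G^i ≠ {id}}`
(it is `0` for the trivial extension, the supremum being taken in `[0, ∞)`). -/
def ramConductor : ℝ :=
  sSup {i : ℝ | 0 ≤ i ∧ upperGroup A L K i ≠ {1}}

end General

section Cyclotomic

variable (p : ℕ) (K₀ Ω : Type*) [Field K₀] [Field Ω] [Algebra K₀ Ω]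

/-- `K_n = K_0(ζ_{p^n})`, inside the algebraic closure `Ω` of `K_0`. -/
def cyc (n : ℕ) : IntermediateField K₀ Ω :=
  IntermediateField.adjoin K₀ {ζ : Ω | IsPrimitiveRoot ζ (p ^ n)}

/-- If `A` acts compatibly on `K_0` and `Ω`, then its action on an intermediate field is
compatible with the one on `Ω`. -/
instance isScalarTower_top (A : Type*) [CommRing A] [Algebra A K₀] [Algebra A Ω]
    [IsScalarTower A K₀ Ω] (E : IntermediateField K₀ Ω) : IsScalarTower A E Ω :=
  IsScalarTower.of_algebraMap_eq fun _ => rfl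

/-- The field `K_{max(ℓ, c)}(b)`, regarded as an extension of `K_ℓ`. -/
def kummerExt (ℓ c : ℕ) (b : Ω) : IntermediateField (cyc p K₀ Ω ℓ) Ω :=
  IntermediateField.adjoin (cyc p K₀ Ω ℓ) ((cyc p K₀ Ω (max ℓ c) : Set Ω) ∪ {b})

/-- The Galois closure over `K_0` of `K_{max(ℓ, c)}(b)`, inside `Ω`. -/
def kummerClosure (ℓ c : ℕ) (b : Ω) : IntermediateField K₀ Ω :=
  IntermediateField.normalClosure K₀ ((kummerExt p K₀ Ω ℓ c b).restrictScalars K₀) Ω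

end Cyclotomic

end RamificationConductor

end

/-
Normalize the valuation by `w p = 1`, and for a Galois extension `N / F` with uniformizer `π` of `N`
put `j g = w (g π - π)`. Since the residue field is algebraically closed, everything is totally
ramified, and the conductor is an affine function of `∑ g, min (j g) t`, where `t` is the largest
value of `j` away from the identity. These sums can be computed step by step along a tower of
intermediate fields `M ⊆ M'`: if `ϖ` is a uniformizer of `M'`, then by Hilbert's formula
`w (g ϖ - ϖ)` is the sum of `j` over the coset of `g` modulo the automorphisms fixing `M'`. No step
has to be Galois as long as `w (g ϖ - ϖ)` has the same value for all conjugates `g ϖ ≠ ϖ` over `M`.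

Adjoining a `p`-th root of a `p`-primitive element `a` with `v (a - 1) = n` is such a step of degree
`p`, and the root is again `p`-primitive with the same `n`. Let `β = 1 / (p - 1) - (n - 1) / e` with
`e = v p` in the base of the step, and let `β'` be its analogue upstairs, where `e' = p e`; then
`w (g ϖ - ϖ) = β'` and `p β' = β + 1`. So every further root raises the break, measured over the
base, by exactly `1`, to `β + c` after `c` roots. The cyclotomic tower above `K_1` is the special
case `a = ζ_p`, `n = 1`.

The largest `j` is attained outside the automorphisms fixing `K_ℓ(b)`, where `b` is the `p ^ c`-th
root of `a`, even though `K_ℓ(b)` is not Galois: the ramification groups are normal, while a normal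
subgroup fixing `K_ℓ(b)` is trivial, since a normal extension containing `b` contains all conjugates
of `b`, hence the `p ^ c`-th roots of unity. The conductor of the Galois closure is thus the larger
one of those of the cyclotomic and the Kummer part.
-/

noncomputable section

namespace RamificationConductor

section CompleteDVR

open IsLocalRing

theorem isPrecomplete_of_surjective {A M N : Type*} [CommRing A] (I : Ideal A) [AddCommGroup M]
    [Module A M] [AddCommGroup N] [Module A N] [IsPrecomplete I M] {f : M →ₗ[A] N}
    (hf : Function.Surjective f) : IsPrecomplete I N := by
  refine AdicCompletion.of_surjective_iff.1 fun y => ?_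
  obtain ⟨x, rfl⟩ := AdicCompletion.map_surjective I hf y
  obtain ⟨m, rfl⟩ := AdicCompletion.of_surjective I M x
  exact ⟨f m, (AdicCompletion.map_of I f m).symm⟩

theorem isPrecomplete_pi {A ι : Type*} [CommRing A] (I : Ideal A) [Finite ι] (M : ι → Type*)
    [∀ i, AddCommGroup (M i)] [∀ i, Module A (M i)] [∀ i, IsPrecomplete I (M i)] :
    IsPrecomplete I (∀ i, M i) := by
  classical
  have := Fintype.ofFinite ι
  refine AdicCompletion.of_surjective_iff.1 fun y => ?_
  choose x hx using fun i =>
    AdicCompletion.of_surjective I (M i) (AdicCompletion.map I (LinearMap.proj i) y)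
  refine ⟨x, (AdicCompletion.piEquivOfFintype I M).injective (funext fun i => ?_)⟩
  rw [AdicCompletion.piEquivOfFintype_apply, AdicCompletion.piEquivOfFintype_apply,
    AdicCompletion.pi, LinearMap.pi_apply, LinearMap.pi_apply, ← hx i, AdicCompletion.map_of]
  rfl

theorem isAdicComplete_of_finite {A : Type*} [CommRing A] [IsNoetherianRing A] (I : Ideal A)
    [IsAdicComplete I A] (M : Type*) [AddCommGroup M] [Module A M] [Module.Finite A M] :
    IsAdicComplete I M := by
  obtain ⟨n, f, hf⟩ := Module.Finite.exists_fin' A M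
  have := isPrecomplete_pi I fun _ : Fin n => A
  exact { IsHausdorff.of_le_jacobson I M (IsAdicComplete.le_jacobson_bot I),
          isPrecomplete_of_surjective I hf with }

theorem exists_isIdempotentElem_of_henselianRing {B : Type*} [CommRing B] (I : Ideal B)
    [HenselianRing B I] {e : B ⧸ I} (he : IsIdempotentElem e) :
    ∃ a : B, IsIdempotentElem a ∧ Ideal.Quotient.mk I a = e := by
  obtain ⟨e, rfl⟩ := Ideal.Quotient.mk_surjective e
  let f : Polynomial B := Polynomial.X ^ 2 - Polynomial.X
  have hmonic : f.Monic := by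
    unfold f
    monicity!
  have heval (x : B) : f.eval x = x ^ 2 - x := by simp [f]
  have hroot : f.eval e ∈ I := by
    rw [heval, ← Ideal.Quotient.eq_zero_iff_mem, map_sub, map_pow, pow_two, he.eq, sub_self]
  have hderiv : f.derivative.eval e = 2 * e - 1 := by
    simp [f, one_add_one_eq_two]
  -- `(2 e - 1) ^ 2 = 1` for an idempotent `e`
  have hunit : IsUnit (Ideal.Quotient.mk I (f.derivative.eval e)) := by
    refine IsUnit.of_mul_eq_one (Ideal.Quotient.mk I (2 * e - 1)) ?_
    rw [hderiv]
    simp only [map_sub, map_mul, map_ofNat, map_one]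
    linear_combination 4 * he.eq
  obtain ⟨a, ha, hae⟩ := HenselianRing.is_henselian f hmonic e hroot hunit
  refine ⟨a, ?_, Ideal.Quotient.eq.2 hae⟩
  have : a ^ 2 - a = 0 := heval a ▸ ha
  rw [IsIdempotentElem]
  linear_combination this

theorem isLocalRing_of_isArtinianRing {R : Type*} [CommRing R] [Nontrivial R] [IsArtinianRing R]
    (hR : ∀ e : R, IsIdempotentElem e → e = 0 ∨ e = 1) : IsLocalRing R := by
  have : Subsingleton (PrimeSpectrum R) := by
    refine ⟨fun x y => ?_⟩
    obtain ⟨e, he, hex⟩ :=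
      PrimeSpectrum.exists_idempotent_basicOpen_eq_of_isClopen (isClopen_discrete {x})
    rcases hR e he with rfl | rfl
    · simp at hex
    · have : y ∈ ({x} : Set (PrimeSpectrum R)) := by simp [hex]
      exact this.symm
  have : Subsingleton (MaximalSpectrum R) :=
    MaximalSpectrum.toPrimeSpectrum_injective.subsingleton
  exact IsLocalRing.of_singleton_maximalSpectrum

theorem isLocalRing_of_isAdicComplete {B : Type*} [CommRing B] [IsDomain B]
    (I : Ideal B) [IsAdicComplete I B] [IsArtinianRing (B ⧸ I)] (hI : I ≠ ⊤) :
    IsLocalRing B := by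
  have : IsLocalHom (Ideal.Quotient.mk I) :=
    isLocalHom_of_le_jacobson_bot I (IsAdicComplete.le_jacobson_bot I)
  have : Nontrivial (B ⧸ I) := Ideal.Quotient.nontrivial_iff.2 hI
  have : IsLocalRing (B ⧸ I) := isLocalRing_of_isArtinianRing fun e he => by
    obtain ⟨a, ha, rfl⟩ := exists_isIdempotentElem_of_henselianRing I he
    rcases IsIdempotentElem.iff_eq_zero_or_one.1 ha with rfl | rfl
    · exact .inl (map_zero _)
    · exact .inr (map_one _)
  exact (Ideal.Quotient.mk I).domain_isLocalRing

theorem isLocalRing_of_finite (A : Type*) [CommRing A] [IsNoetherianRing A] [IsLocalRing A]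
    [IsAdicComplete (maximalIdeal A) A] (B : Type*) [CommRing B] [IsDomain B] [Algebra A B]
    [FaithfulSMul A B] [Module.Finite A B] : IsLocalRing B := by
  let I : Ideal B := (maximalIdeal A).map (algebraMap A B)
  have hI : I ≠ ⊤ := by
    have hker : RingHom.ker (algebraMap A B) ≤ maximalIdeal A := by
      rw [(RingHom.injective_iff_ker_eq_bot _).1 (FaithfulSMul.algebraMap_injective A B)]
      exact bot_le
    obtain ⟨Q, hQ, hQA⟩ := Ideal.exists_ideal_over_maximal_of_isIntegral (maximalIdeal A) hker
    exact ne_top_of_le_ne_top hQ.ne_top (Ideal.map_le_iff_le_comap.2 hQA.ge)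
  have : IsAdicComplete (maximalIdeal A) B := isAdicComplete_of_finite _ _
  have : IsAdicComplete I B :=
    { IsHausdorff.map_algebraMap_iff.2 inferInstance,
      IsPrecomplete.map_algebraMap_iff.2 inferInstance with }
  have : IsArtinianRing (A ⧸ maximalIdeal A) := inferInstanceAs (IsArtinianRing (ResidueField A))
  have : Module.Finite (A ⧸ maximalIdeal A) (B ⧸ I) :=
    Module.Finite.of_restrictScalars_finite A (A ⧸ maximalIdeal A) _
  have : IsArtinianRing (B ⧸ I) := IsArtinianRing.of_finite (A ⧸ maximalIdeal A) _
  exact isLocalRing_of_isAdicComplete I hI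

theorem isDiscreteValuationRing_of_finite (A : Type*) [CommRing A] [IsDomain A]
    [IsDiscreteValuationRing A] [IsAdicComplete (maximalIdeal A) A]
    (B : Type*) [CommRing B] [IsDedekindDomain B] [Algebra A B] [FaithfulSMul A B]
    [Module.Finite A B] : IsDiscreteValuationRing B := by
  have : IsLocalRing B := isLocalRing_of_finite A B
  have hB : ¬ IsField B := fun h => IsDiscreteValuationRing.not_isField A
    ((Algebra.IsIntegral.isField_iff_isField (FaithfulSMul.algebraMap_injective A B)).2 h)
  exact ((IsDiscreteValuationRing.TFAE B hB).out 0 2).2 ‹IsDedekindDomain B›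

theorem exists_sub_mem_maximalIdeal (A : Type*) [CommRing A] [IsLocalRing A]
    [IsAlgClosed (ResidueField A)] {B : Type*} [CommRing B] [IsLocalRing B] [Algebra A B]
    [Module.Finite A B] [FaithfulSMul A B] (x : B) :
    ∃ a : A, x - algebraMap A B a ∈ maximalIdeal B := by
  have : IsLocalHom (algebraMap A B) := Algebra.IsIntegral.isLocalHom A B
  obtain ⟨y, hy⟩ := (IsAlgClosed.algebraMap_bijective_of_isIntegral
    (k := ResidueField A) (K := ResidueField B)).2 (residue B x)
  obtain ⟨a, rfl⟩ := residue_surjective y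
  refine ⟨a, ?_⟩
  rw [← residue_eq_zero_iff, map_sub, ← hy, sub_eq_zero]
  rfl

theorem inertiaDeg_maximalIdeal_eq_one (A : Type*) [CommRing A] [IsLocalRing A]
    [IsAlgClosed (ResidueField A)] (B : Type*) [CommRing B] [IsLocalRing B] [Algebra A B]
    [Module.Finite A B] [FaithfulSMul A B] : (maximalIdeal B).inertiaDeg A = 1 := by
  have : IsLocalHom (algebraMap A B) := Algebra.IsIntegral.isLocalHom A B
  rw [Ideal.inertiaDeg_eq_of_isMaximal (maximalIdeal A) (maximalIdeal B)]
  let : Field (A ⧸ maximalIdeal A) := Ideal.Quotient.field _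
  refine finrank_eq_one (1 : B ⧸ maximalIdeal B) one_ne_zero fun x => ?_
  obtain ⟨x, rfl⟩ := Ideal.Quotient.mk_surjective x
  obtain ⟨a, ha⟩ := exists_sub_mem_maximalIdeal A x
  refine ⟨Ideal.Quotient.mk _ a, ?_⟩
  rw [Algebra.smul_def, mul_one, Ideal.Quotient.algebraMap_mk_of_liesOver, eq_comm,
    Ideal.Quotient.eq]
  exact ha

theorem associated_uniformizer_pow_finrank {A : Type*} [CommRing A] [IsDomain A]
    [IsDiscreteValuationRing A] [IsAlgClosed (ResidueField A)] {B : Type*} [CommRing B] [IsDomain B]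
    [IsDiscreteValuationRing B] [Algebra A B] [Module.Finite A B] [Module.Flat A B]
    [FaithfulSMul A B] {a : A} {ϖ : B} (ha : Irreducible a) (hϖ : Irreducible ϖ) :
    Associated (algebraMap A B a) (ϖ ^ Module.finrank A B) := by
  have hB : maximalIdeal B ≠ ⊥ := IsDiscreteValuationRing.not_a_field B
  have hprimes : (maximalIdeal A).primesOver B = {maximalIdeal B} :=
    IsLocalRing.primesOver_eq B (IsDiscreteValuationRing.not_a_field A)
  have : Unique ((maximalIdeal A).primesOver B) := hprimes ▸ Set.uniqueSingleton _
  have hdefault : ((default : (maximalIdeal A).primesOver B) : Ideal B) = maximalIdeal B :=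
    hprimes.subset (default : (maximalIdeal A).primesOver B).2
  have hdeg : (maximalIdeal B).ramificationIdx A = Module.finrank A B := by
    rw [← Ideal.sum_ramification_inertia_eq_finrank (maximalIdeal A) B, Fintype.sum_unique,
      hdefault, inertiaDeg_maximalIdeal_eq_one, mul_one]
  have ha0 : algebraMap A B a ≠ 0 :=
    (map_ne_zero_iff _ (FaithfulSMul.algebraMap_injective A B)).2 ha.ne_zero
  obtain ⟨m, hm⟩ := IsDiscreteValuationRing.associated_pow_irreducible ha0 hϖ
  have hmap : (maximalIdeal A).map (algebraMap A B) = maximalIdeal B ^ m := by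
    rw [ha.maximalIdeal_eq, hϖ.maximalIdeal_eq, Ideal.map_span, Set.image_singleton,
      Ideal.span_singleton_pow, Ideal.span_singleton_eq_span_singleton]
    exact hm
  have : IsLocalHom (algebraMap A B) := Algebra.IsIntegral.isLocalHom A B
  rw [← hdeg, Ideal.IsDedekindDomain.ramificationIdx_eq_multiplicity (maximalIdeal A)
    (maximalIdeal B) (hmap ▸ pow_ne_zero _ hB), hmap, multiplicity_pow_self hB
    (Ideal.isUnit_iff.not.2 (maximalIdeal.isMaximal B).ne_top) m]
  exact hm

end CompleteDVR

section Ord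

variable {A : Type*} [CommRing A] {E : Type*} [Field E] [Algebra A E]

theorem IsUniformizer.ne_zero {ϖ : E} (h : IsUniformizer A E ϖ) : ϖ ≠ 0 := by
  obtain ⟨x, hx, rfl⟩ := h
  simpa using hx.ne_zero

theorem HasOrd.ne_zero {x : E} {n : ℤ} (h : HasOrd A E x n) : x ≠ 0 := by
  obtain ⟨ϖ, hϖ, u, rfl⟩ := h
  exact mul_ne_zero (by simp) (zpow_ne_zero _ hϖ.ne_zero)

theorem coe_integralClosure_unit_zpow (u : (integralClosure A E)ˣ) (n : ℤ) :
    (((u ^ n : (integralClosure A E)ˣ) : integralClosure A E) : E) =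
      ((u : integralClosure A E) : E) ^ n := by
  let f : (integralClosure A E)ˣ →* Eˣ := Units.map (algebraMap (integralClosure A E) E).toMonoidHom
  change ((f (u ^ n) : Eˣ) : E) = (f u : E) ^ n
  rw [map_zpow, Units.val_zpow_eq_zpow_val]

theorem HasOrd.inv {x : E} {m : ℤ} (hx : HasOrd A E x m) : HasOrd A E x⁻¹ (-m) := by
  obtain ⟨ϖ, hϖ, u, rfl⟩ := hx
  refine ⟨ϖ, hϖ, u ^ (-1 : ℤ), ?_⟩
  rw [coe_integralClosure_unit_zpow, zpow_neg_one, mul_inv, zpow_neg]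

theorem HasOrd.nonneg_iff {x : E} {m : ℤ} (hx : HasOrd A E x m) : 0 ≤ m ↔ IsIntegral A x := by
  obtain ⟨_, ⟨y, hy, rfl⟩, u, rfl⟩ := hx
  refine ⟨fun hm => ?_, fun hi => ?_⟩
  · lift m to ℕ using hm
    simpa [mem_integralClosure_iff] using ((u : integralClosure A E) * y ^ m).2
  · by_contra! hm
    obtain ⟨k, rfl⟩ : ∃ k : ℕ, m = -((k : ℤ) + 1) := ⟨(-m - 1).toNat, by omega⟩
    have hy0 : (y : E) ≠ 0 := by simpa using hy.ne_zero
    let z : integralClosure A E := ⟨_, hi⟩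
    have hz : z * y ^ (k + 1) = u := by
      apply Subtype.ext
      change ((u : integralClosure A E) : E) * (y : E) ^ (-((k : ℤ) + 1)) * (y : E) ^ (k + 1) = _
      rw [mul_assoc, zpow_neg, ← Nat.cast_succ, zpow_natCast, inv_mul_cancel₀ (pow_ne_zero _ hy0),
        mul_one]
    have hdvd : y ∣ u := ⟨z * y ^ k, by rw [← hz]; ring⟩
    exact hy.not_isUnit (isUnit_of_dvd_unit hdvd u.isUnit)

variable [IsDiscreteValuationRing (integralClosure A E)]

variable (A E) in
theorem exists_isUniformizer : ∃ ϖ : E, IsUniformizer A E ϖ := by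
  obtain ⟨x, hx⟩ := IsDiscreteValuationRing.exists_irreducible (integralClosure A E)
  exact ⟨x, x, hx, rfl⟩

theorem IsUniformizer.exists_unit_mul {ϖ ϖ' : E} (h : IsUniformizer A E ϖ)
    (h' : IsUniformizer A E ϖ') :
    ∃ u : (integralClosure A E)ˣ, ϖ' = ((u : integralClosure A E) : E) * ϖ := by
  obtain ⟨x, hx, rfl⟩ := h
  obtain ⟨y, hy, rfl⟩ := h'
  obtain ⟨u, hu⟩ := IsDiscreteValuationRing.associated_of_irreducible _ hx hy
  exact ⟨u, by rw [← hu, mul_comm]; rfl⟩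

theorem HasOrd.exists_unit {x : E} {n : ℤ} (h : HasOrd A E x n) {ϖ : E}
    (hϖ : IsUniformizer A E ϖ) :
    ∃ u : (integralClosure A E)ˣ, x = ((u : integralClosure A E) : E) * ϖ ^ n := by
  obtain ⟨ϖ', hϖ', u, rfl⟩ := h
  obtain ⟨v, rfl⟩ := hϖ.exists_unit_mul hϖ'
  refine ⟨u * v ^ n, ?_⟩
  rw [Units.val_mul, MulMemClass.coe_mul, coe_integralClosure_unit_zpow, mul_zpow, mul_assoc]

theorem hasOrd_one : HasOrd A E 1 0 := by
  obtain ⟨ϖ, hϖ⟩ := exists_isUniformizer A E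
  exact ⟨ϖ, hϖ, 1, by simp⟩

theorem HasOrd.mul {x y : E} {m n : ℤ} (hx : HasOrd A E x m) (hy : HasOrd A E y n) :
    HasOrd A E (x * y) (m + n) := by
  obtain ⟨ϖ, hϖ, u, rfl⟩ := hx
  obtain ⟨v, rfl⟩ := hy.exists_unit hϖ
  refine ⟨ϖ, hϖ, u * v, ?_⟩
  rw [zpow_add₀ hϖ.ne_zero, Units.val_mul, MulMemClass.coe_mul, mul_mul_mul_comm]

theorem HasOrd.unique {x : E} {m n : ℤ} (hm : HasOrd A E x m) (hn : HasOrd A E x n) : m = n := by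
  have hx := hm.ne_zero
  have h1 : HasOrd A E 1 (m + -n) := by simpa [hx] using hm.mul hn.inv
  have h2 : HasOrd A E 1 (n + -m) := by simpa [hx] using hn.mul hm.inv
  have := h1.nonneg_iff.2 isIntegral_one
  have := h2.nonneg_iff.2 isIntegral_one
  omega

theorem ord_eq_coe_iff {x : E} {n : ℤ} : ord A E x = n ↔ HasOrd A E x n := by
  unfold ord
  split_ifs with h
  · rw [WithTop.coe_inj]
    exact ⟨fun hn => hn ▸ h.choose_spec, fun hn => h.choose_spec.unique hn⟩
  · simp only [WithTop.top_ne_coe, false_iff]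
    exact fun hn => h ⟨n, hn⟩

theorem IsUniformizer.ord_eq {ϖ : E} (h : IsUniformizer A E ϖ) : ord A E ϖ = (1 : ℤ) :=
  ord_eq_coe_iff.2 ⟨ϖ, h, 1, by simp⟩

variable [IsFractionRing (integralClosure A E) E]

theorem exists_hasOrd {x : E} (hx : x ≠ 0) : ∃ n, HasOrd A E x n := by
  obtain ⟨_, y, hy, rfl⟩ := exists_isUniformizer A E
  obtain ⟨n, u, h⟩ := IsDiscreteValuationRing.exists_units_eq_smul_zpow_of_irreducible hy hx
  exact ⟨n, y, ⟨y, hy, rfl⟩, u, by rw [h]; rfl⟩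

theorem ord_eq_top_iff {x : E} : ord A E x = ⊤ ↔ x = 0 := by
  refine ⟨fun h => ?_, ?_⟩
  · by_contra hx
    obtain ⟨n, hn⟩ := exists_hasOrd (A := A) hx
    exact WithTop.coe_ne_top ((ord_eq_coe_iff.2 hn).symm.trans h)
  · rintro rfl
    exact dif_neg fun ⟨_, hn⟩ => hn.ne_zero rfl

theorem ord_nonneg_iff {x : E} : 0 ≤ ord A E x ↔ IsIntegral A x := by
  rcases eq_or_ne x 0 with rfl | hx
  · simp [ord_eq_top_iff.2, isIntegral_zero]
  · obtain ⟨n, hn⟩ := exists_hasOrd (A := A) hx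
    rw [ord_eq_coe_iff.2 hn, ← hn.nonneg_iff]
    exact_mod_cast Iff.rfl

theorem ord_mul (x y : E) : ord A E (x * y) = ord A E x + ord A E y := by
  rcases eq_or_ne x 0 with rfl | hx
  · simp [ord_eq_top_iff.2]
  rcases eq_or_ne y 0 with rfl | hy
  · simp [ord_eq_top_iff.2]
  obtain ⟨m, hm⟩ := exists_hasOrd (A := A) hx
  obtain ⟨n, hn⟩ := exists_hasOrd (A := A) hy
  rw [ord_eq_coe_iff.2 hm, ord_eq_coe_iff.2 hn, ord_eq_coe_iff.2 (hm.mul hn)]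
  rfl

theorem ord_le_ord_add {x y : E} (hxy : ord A E x ≤ ord A E y) :
    ord A E x ≤ ord A E (x + y) := by
  rcases eq_or_ne x 0 with rfl | hx
  · simpa using hxy
  rcases eq_or_ne y 0 with rfl | hy
  · simp
  obtain ⟨m, hm⟩ := exists_hasOrd (A := A) hx
  obtain ⟨n, hn⟩ := exists_hasOrd (A := A) hy
  have hmn : m ≤ n := by
    rw [ord_eq_coe_iff.2 hm, ord_eq_coe_iff.2 hn] at hxy
    exact_mod_cast hxy
  have hyx : IsIntegral A (y * x⁻¹) := (hn.mul hm.inv).nonneg_iff.1 (by omega)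
  have hxy' : x + y = x * (1 + y * x⁻¹) := by field_simp
  rw [hxy', ord_mul]
  exact le_add_of_nonneg_right (ord_nonneg_iff.2 (isIntegral_one.add hyx))

variable (A E) in
/-- The normalized valuation `ord` of `E` as an additive valuation. -/
def ordValuation : AddValuation E (WithTop ℤ) :=
  AddValuation.of (ord A E) (ord_eq_top_iff.2 rfl) (ord_eq_coe_iff.2 hasOrd_one)
    (fun x y => by
      rcases le_total (ord A E x) (ord A E y) with h | h
      · rw [min_eq_left h]
        exact ord_le_ord_add h
      · rw [min_eq_right h, add_comm]
        exact ord_le_ord_add h)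
    ord_mul

end Ord

theorem valuation_pow_of_eq_coe {E : Type*} [Ring E] (w : AddValuation E (WithTop ℝ)) {x : E}
    {r : ℝ} (hr : w x = r) (n : ℕ) : w (x ^ n) = ((n * r : ℝ) : WithTop ℝ) := by
  rw [w.map_pow, hr, ← WithTop.coe_nsmul, nsmul_eq_mul]

theorem valuation_zpow_of_eq_coe {E : Type*} [Field E] (w : AddValuation E (WithTop ℝ)) {x : E}
    {r : ℝ} (hr : w x = r) (n : ℤ) : w (x ^ n) = ((n * r : ℝ) : WithTop ℝ) := by
  obtain ⟨m, rfl | rfl⟩ := n.eq_nat_or_neg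
  · simpa using valuation_pow_of_eq_coe w hr m
  · rw [zpow_neg, zpow_natCast, w.map_inv, valuation_pow_of_eq_coe w hr]
    norm_cast
    push_cast
    rw [neg_mul]

theorem valuation_prod {E ι : Type*} [CommRing E] (w : AddValuation E (WithTop ℝ)) (s : Finset ι)
    (f : ι → E) : w (∏ i ∈ s, f i) = ∑ i ∈ s, w (f i) := by
  induction s using Finset.cons_induction with
  | empty => simp
  | cons i s hi ih => rw [Finset.prod_cons, Finset.sum_cons, w.map_mul, ih]

section ExtendedValuation

open IsLocalRing Module

section IntegralClosure

variable (A K E : Type*) [CommRing A] [Field K] [Algebra A K] [IsFractionRing A K] [Field E]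
  [Algebra K E] [Algebra A E] [IsScalarTower A K E]

include K

theorem faithfulSMul_of_isFractionRing : FaithfulSMul A E := by
  rw [faithfulSMul_iff_algebraMap_injective, IsScalarTower.algebraMap_eq A K E]
  exact (algebraMap K E).injective.comp (IsFractionRing.injective A K)

variable [IsDomain A] [FiniteDimensional K E]

theorem isFractionRing_integralClosure : IsFractionRing (integralClosure A E) E :=
  integralClosure.isFractionRing_of_finite_extension K E

variable [IsDiscreteValuationRing A] [Algebra.IsSeparable K E]

theorem finite_integralClosure : Module.Finite A (integralClosure A E) :=
  IsIntegralClosure.finite A K E (integralClosure A E)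

theorem free_integralClosure : Module.Free A (integralClosure A E) := by
  have := faithfulSMul_of_isFractionRing A K E
  exact IsIntegralClosure.module_free A K E (integralClosure A E)

theorem finrank_integralClosure : finrank A (integralClosure A E) = finrank K E := by
  have := faithfulSMul_of_isFractionRing A K E
  exact IsIntegralClosure.rank A K E (integralClosure A E)

theorem isDiscreteValuationRing_integralClosure [IsAdicComplete (maximalIdeal A) A] :
    IsDiscreteValuationRing (integralClosure A E) := by
  have := finite_integralClosure A K E
  have := faithfulSMul_of_isFractionRing A K E
  have := integralClosure.isDedekindDomain A K E
  exact isDiscreteValuationRing_of_finite A (integralClosure A E)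

end IntegralClosure

variable (A : Type*) [CommRing A] [IsDomain A] [IsDiscreteValuationRing A]
  [IsAdicComplete (maximalIdeal A) A] (K : Type*) [Field K] [Algebra A K] [IsFractionRing A K]
  (E : Type*) [Field E] [Algebra K E] [Algebra A E] [IsScalarTower A K E]
  [FiniteDimensional K E] [Algebra.IsSeparable K E]

/-- The valuation `v_E / [E : K]` of a finite extension `E` of `K = Frac A`. When `E / K` is totally
ramified it takes the value `1` at the uniformizers of `A`, so it is the same valuation on all the
fields that occur here. -/
def extVal : AddValuation E (WithTop ℝ) :=
  haveI := isDiscreteValuationRing_integralClosure A K E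
  haveI := isFractionRing_integralClosure A K E
  (ordValuation A E).map
    (AddMonoidHom.withTopMap (AddMonoidHom.mulRight ((finrank K E : ℝ)⁻¹) |>.comp
      (Int.castAddHom ℝ))) rfl (by
      refine WithTop.monotone_map_iff.2 fun m n h => ?_
      have h' : (m : ℝ) ≤ n := by exact_mod_cast h
      exact mul_le_mul_of_nonneg_right h' (by positivity))

variable {E}

theorem extVal_apply (x : E) :
    extVal A K E x = (ord A E x).map fun n : ℤ => (n : ℝ) * (finrank K E : ℝ)⁻¹ := rfl

theorem extVal_eq_of_ord_eq {x : E} {n : ℤ} (h : ord A E x = n) :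
    extVal A K E x = ((n * (finrank K E : ℝ)⁻¹ : ℝ) : WithTop ℝ) := by
  rw [extVal_apply, h]
  rfl

theorem inv_finrank_pos (K E : Type*) [Field K] [Field E] [Algebra K E] [FiniteDimensional K E] :
    0 < (finrank K E : ℝ)⁻¹ :=
  inv_pos.2 (by exact_mod_cast finrank_pos (R := K) (M := E))

theorem ord_eq_of_extVal_eq {x : E} {n : ℤ}
    (h : extVal A K E x = ((n * (finrank K E : ℝ)⁻¹ : ℝ) : WithTop ℝ)) : ord A E x = n := by
  rw [extVal_apply] at h
  cases hx : ord A E x with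
  | top =>
    rw [hx, WithTop.map_top] at h
    exact absurd h WithTop.top_ne_coe
  | coe m =>
    rw [hx, WithTop.map_coe, WithTop.coe_inj] at h
    have : (m : ℝ) = n := mul_right_cancel₀ (inv_finrank_pos K E).ne' h
    exact_mod_cast this

theorem exists_extVal_eq {x : E} (hx : x ≠ 0) :
    ∃ n : ℤ, extVal A K E x = ((n * (finrank K E : ℝ)⁻¹ : ℝ) : WithTop ℝ) := by
  have := isDiscreteValuationRing_integralClosure A K E
  have := isFractionRing_integralClosure A K E
  obtain ⟨n, hn⟩ := exists_hasOrd (A := A) hx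
  exact ⟨n, extVal_eq_of_ord_eq A K (ord_eq_coe_iff.2 hn)⟩

theorem extVal_nonneg_iff {x : E} : 0 ≤ extVal A K E x ↔ IsIntegral A x := by
  have := isDiscreteValuationRing_integralClosure A K E
  have := isFractionRing_integralClosure A K E
  rw [← ord_nonneg_iff, extVal_apply]
  cases ord A E x with
  | top => simp
  | coe n =>
    rw [WithTop.map_coe]
    norm_cast
    rw [mul_nonneg_iff_of_pos_right (inv_finrank_pos K E)]
    norm_cast

theorem extVal_map_unit {F : Type*} [Field F] [Algebra A F] (f : F →ₐ[A] E)
    (u : (integralClosure A F)ˣ) : extVal A K E (f (u : integralClosure A F)) = 0 := by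
  have hint (y : integralClosure A F) : 0 ≤ extVal A K E (f y) :=
    (extVal_nonneg_iff A K).2 (y.2.map f)
  have hsum : extVal A K E (f (u : integralClosure A F)) +
      extVal A K E (f ((u⁻¹ : (integralClosure A F)ˣ) : integralClosure A F)) = 0 := by
    rw [← AddValuation.map_mul, ← map_mul, ← MulMemClass.coe_mul, Units.mul_inv]
    simp
  exact le_antisymm (hsum ▸ le_add_of_nonneg_right (hint _)) (hint _)

theorem extVal_of_isUniformizer {ϖ : E} (hϖ : IsUniformizer A E ϖ) :
    extVal A K E ϖ = ((finrank K E : ℝ)⁻¹ : ℝ) := by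
  have := isDiscreteValuationRing_integralClosure A K E
  simpa using extVal_eq_of_ord_eq A K hϖ.ord_eq

variable (E) in
theorem exists_extVal_eq_inv_finrank :
    ∃ x : E, extVal A K E x = ((finrank K E : ℝ)⁻¹ : ℝ) := by
  have := isDiscreteValuationRing_integralClosure A K E
  obtain ⟨ϖ, hϖ⟩ := exists_isUniformizer A E
  exact ⟨ϖ, extVal_of_isUniformizer A K hϖ⟩

variable [IsAlgClosed (ResidueField A)]

variable (E) in
theorem ord_algebraMap_of_irreducible {a : A} (ha : Irreducible a) :
    ord A E (algebraMap A E a) = (finrank K E : ℤ) := by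
  have := finite_integralClosure A K E
  have := free_integralClosure A K E
  have := faithfulSMul_of_isFractionRing A K E
  have := isDiscreteValuationRing_integralClosure A K E
  have := isFractionRing_integralClosure A K E
  obtain ⟨ϖ, hϖ⟩ := IsDiscreteValuationRing.exists_irreducible (integralClosure A E)
  obtain ⟨u, hu⟩ := (associated_uniformizer_pow_finrank ha hϖ).symm
  rw [finrank_integralClosure A K E] at hu
  refine ord_eq_coe_iff.2 ⟨ϖ, ⟨ϖ, hϖ, rfl⟩, u, ?_⟩
  rw [IsScalarTower.algebraMap_apply A (integralClosure A E) E, ← hu, mul_comm, zpow_natCast]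
  simp [Algebra.algebraMap_eq_smul_one, Subalgebra.smul_def]

variable (E) in
theorem extVal_algebraMap_of_irreducible {a : A} (ha : Irreducible a) :
    extVal A K E (algebraMap A E a) = 1 := by
  rw [extVal_eq_of_ord_eq A K (ord_algebraMap_of_irreducible A K E ha)]
  norm_cast
  exact mul_inv_cancel₀ (inv_pos.1 (inv_finrank_pos K E)).ne'

theorem exists_pos_extVal_sub {x : E} (hx : 0 ≤ extVal A K E x) :
    ∃ a : A, 0 < extVal A K E (x - algebraMap A E a) := by
  have := finite_integralClosure A K E
  have := faithfulSMul_of_isFractionRing A K E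
  have := isDiscreteValuationRing_integralClosure A K E
  obtain ⟨a, ha⟩ := exists_sub_mem_maximalIdeal A
    (⟨x, (extVal_nonneg_iff A K).1 hx⟩ : integralClosure A E)
  obtain ⟨ϖ, hϖ⟩ := IsDiscreteValuationRing.exists_irreducible (integralClosure A E)
  rw [hϖ.maximalIdeal_eq, Ideal.mem_span_singleton] at ha
  obtain ⟨c, hc⟩ := ha
  have hc' : x - algebraMap A E a = ϖ * c := congrArg Subtype.val hc
  have hϖ_pos : 0 < extVal A K E ϖ := by
    rw [extVal_of_isUniformizer A K ⟨ϖ, hϖ, rfl⟩]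
    exact_mod_cast inv_finrank_pos K E
  refine ⟨a, ?_⟩
  rw [hc', AddValuation.map_mul]
  exact add_pos_of_pos_of_nonneg hϖ_pos ((extVal_nonneg_iff A K).2 c.2)

variable {E' : Type*} [Field E'] [Algebra K E'] [Algebra A E'] [IsScalarTower A K E']
  [FiniteDimensional K E'] [Algebra.IsSeparable K E']

theorem extVal_map (f : E →ₐ[A] E') (x : E) : extVal A K E' (f x) = extVal A K E x := by
  have := isDiscreteValuationRing_integralClosure A K E
  have := isFractionRing_integralClosure A K E
  rcases eq_or_ne x 0 with rfl | hx
  · simp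
  obtain ⟨ϖ, hϖ⟩ := exists_isUniformizer A E
  have hfϖ : f ϖ ≠ 0 := by simpa using hϖ.ne_zero
  obtain ⟨r, hr⟩ := WithTop.ne_top_iff_exists.1
    ((AddValuation.ne_top_iff (extVal A K E')).2 hfϖ)
  have hzpow (u : (integralClosure A E)ˣ) (n : ℤ) :
      extVal A K E' (f ((u : integralClosure A E) * ϖ ^ n)) = ((n * r : ℝ) : WithTop ℝ) := by
    rw [map_mul, AddValuation.map_mul, extVal_map_unit, zero_add, map_zpow₀,
      valuation_zpow_of_eq_coe _ hr.symm]
  obtain ⟨p, hp⟩ := IsDiscreteValuationRing.exists_irreducible A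
  obtain ⟨u, hu⟩ := (ord_eq_coe_iff.1 (ord_algebraMap_of_irreducible A K E hp)).exists_unit hϖ
  have hr_eq : (finrank K E : ℝ) * r = 1 := by
    have := extVal_algebraMap_of_irreducible A K E' hp
    rw [← f.commutes, hu, hzpow] at this
    exact_mod_cast this
  obtain ⟨n, hn⟩ := exists_hasOrd (A := A) hx
  rw [extVal_eq_of_ord_eq A K (ord_eq_coe_iff.2 hn)]
  obtain ⟨v, rfl⟩ := hn.exists_unit hϖ
  rw [hzpow, eq_inv_of_mul_eq_one_right hr_eq]

end ExtendedValuation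

section RamificationFunction

open Finset

variable {G : Type*} [Group G] {j : G → ℝ}

/-- The properties of the function `g ↦ v(g π - π)` on the inertia group, `π` a uniformizer. Its
true value at `1` is infinite, so the real number `j 1` is never used. -/
structure IsRamFun (j : G → ℝ) : Prop where
  mul : ∀ g h, g ≠ 1 → h ≠ 1 → g * h ≠ 1 → min (j g) (j h) ≤ j (g * h)
  inv : ∀ g, j g⁻¹ = j g
  conj : ∀ g h, j (h * g * h⁻¹) = j g

open Classical in
/-- `min (j g) s`, where `j 1` is read as infinity. -/
def cap (j : G → ℝ) (g : G) (s : ℝ) : ℝ := if g = 1 then s else min (j g) s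

/-- The Herbrand function `s ↦ ∑ h ∈ H, min (j h) s` of a subgroup `H`, in the normalization in
which the jumps of the lower numbering are the values of `j` themselves. -/
def herbrandSum (j : G → ℝ) (H : Subgroup G) (s : ℝ) : ℝ := ∑ᶠ h : H, cap j h s

theorem cap_one (s : ℝ) : cap j 1 s = s := if_pos rfl

theorem cap_of_ne_one {g : G} (hg : g ≠ 1) (s : ℝ) : cap j g s = min (j g) s := if_neg hg

theorem cap_mono (g : G) : Monotone (cap j g) := by
  intro s t hst
  unfold cap
  split_ifs
  · exact hst
  · exact min_le_min_left _ hst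

theorem min_cap (g : G) (s t : ℝ) : min (cap j g s) t = cap j g (min s t) := by
  unfold cap
  split_ifs
  · rfl
  · rw [min_assoc]

theorem herbrandSum_top (s : ℝ) : herbrandSum j ⊤ s = ∑ᶠ g, cap j g s :=
  finsum_comp_equiv (Subgroup.topEquiv : (⊤ : Subgroup G) ≃* G).toEquiv (f := fun g => cap j g s)

theorem continuous_cap (g : G) : Continuous (cap j g) := by
  unfold cap
  split_ifs
  · exact continuous_id
  · exact continuous_const.min continuous_id

theorem IsRamFun.apply_mul_eq_cap (hj : IsRamFun j) {H : Subgroup G} {g : G} (hg : g ∉ H)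
    (hmax : ∀ h ∈ H, j (g * h) ≤ j g) {h : G} (hh : h ∈ H) : j (g * h) = cap j h (j g) := by
  rcases eq_or_ne h 1 with rfl | h_ne
  · rw [mul_one, cap_one]
  have g_ne : g ≠ 1 := by
    rintro rfl
    exact hg H.one_mem
  have gh_ne : g * h ≠ 1 := fun h1 => hg (eq_inv_of_mul_eq_one_left h1 ▸ H.inv_mem hh)
  rw [cap_of_ne_one h_ne]
  have hgh : min (j g) (j h) ≤ j (g * h) := hj.mul g h g_ne h_ne gh_ne
  have hh' : min (j g) (j (g * h)) ≤ j h := by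
    simpa [hj.inv] using hj.mul g⁻¹ (g * h) (inv_ne_one.2 g_ne) gh_ne (by simpa using h_ne)
  rw [min_eq_right (hmax h hh)] at hh'
  exact le_antisymm (le_min hh' (hmax h hh)) (min_comm (j g) (j h) ▸ hgh)

theorem IsRamFun.exists_max_notMem [Finite G] [Nontrivial G] (hj : IsRamFun j) {H : Subgroup G}
    (hH : H.normalCore = ⊥) : ∃ g ∉ H, ∀ x, x ≠ 1 → j x ≤ j g := by
  obtain ⟨x₀, hx₀, hmax⟩ := Set.exists_max_image {x : G | x ≠ 1} j (Set.toFinite _) (exists_ne 1)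
  let Q : Subgroup G :=
    { carrier := {x | x = 1 ∨ j x₀ ≤ j x}
      one_mem' := Or.inl rfl
      inv_mem' := by
        rintro x (rfl | hx)
        · exact Or.inl inv_one
        · exact Or.inr (by rwa [hj.inv])
      mul_mem' := by
        intro x y hx hy
        by_cases hx1 : x = 1
        · simpa [hx1] using hy
        by_cases hy1 : y = 1
        · simpa [hy1] using hx
        refine or_iff_not_imp_left.2 fun hxy => ?_
        exact (le_min (hx.resolve_left hx1) (hy.resolve_left hy1)).trans (hj.mul x y hx1 hy1 hxy) }
  have hQ : Q.Normal := ⟨by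
    rintro x (rfl | hx) y
    · exact Or.inl (by group)
    · exact Or.inr (by rwa [hj.conj])⟩
  have hQH : ¬ Q ≤ H := fun h => hx₀ <| Subgroup.mem_bot.1 <|
    hH ▸ Subgroup.normal_le_normalCore.2 h (show x₀ ∈ Q from Or.inr le_rfl)
  obtain ⟨g, hgQ, hg⟩ := SetLike.not_le_iff_exists.1 hQH
  refine ⟨g, hg, fun x hx => (hmax x hx).trans (hgQ.resolve_left ?_)⟩
  rintro rfl
  exact hg H.one_mem

theorem sum_sum_mul_eq_card_mul_sum (H : Subgroup G) [Fintype H] {S : Finset G}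
    (hS : ∀ g ∈ S, ∀ h ∈ H, g * h ∈ S) (f : G → ℝ) :
    ∑ g ∈ S, ∑ h : H, f (g * h) = Nat.card H * ∑ g ∈ S, f g := by
  have htranslate (h : H) : ∑ g ∈ S, f (g * h) = ∑ g ∈ S, f g :=
    sum_nbij' (· * (h : G)) (· * (h : G)⁻¹) (fun g hg => hS g hg h h.2)
      (fun g hg => hS g hg _ (H.inv_mem h.2)) (by simp) (by simp) (by simp)
  rw [sum_comm, sum_congr rfl fun h _ => htranslate h, sum_const, nsmul_eq_mul, card_univ,
    Nat.card_eq_fintype_card]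

theorem finsum_subgroup_mul_left {H : Subgroup G} {h₀ : G} (hh₀ : h₀ ∈ H) (f : G → ℝ) :
    ∑ᶠ h : H, f (h₀ * h) = ∑ᶠ h : H, f h :=
  finsum_comp_equiv (Equiv.mulLeft (⟨h₀, hh₀⟩ : H)) (f := fun h : H => f h)

variable [Finite G]

theorem herbrandSum_mono (H : Subgroup G) : Monotone (herbrandSum j H) := fun _ _ hst =>
  finsum_le_finsum' (Set.toFinite _) (Set.toFinite _) fun h => cap_mono (h : G) hst

theorem herbrandSum_strictMono (H : Subgroup G) : StrictMono (herbrandSum j H) := by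
  intro s t hst
  have := Fintype.ofFinite H
  simp only [herbrandSum, finsum_eq_sum_of_fintype]
  refine sum_lt_sum (fun g _ => cap_mono _ hst.le) ⟨1, mem_univ _, ?_⟩
  simpa [cap] using hst

theorem continuous_herbrandSum (H : Subgroup G) : Continuous (herbrandSum j H) := by
  have := Fintype.ofFinite H
  unfold herbrandSum
  simp only [finsum_eq_sum_of_fintype]
  exact continuous_finsetSum _ fun h _ => continuous_cap (h : G)

theorem le_herbrandSum {H : Subgroup G} (hj : ∀ h ∈ H, h ≠ 1 → 0 ≤ j h) {s : ℝ} (hs : 0 ≤ s) :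
    s ≤ herbrandSum j H s := by
  have := Fintype.ofFinite H
  have hnonneg (h : H) : 0 ≤ cap j h s := by
    unfold cap
    split_ifs with h1
    · exact hs
    · exact le_min (hj h h.2 h1) hs
  rw [herbrandSum, finsum_eq_sum_of_fintype]
  calc s = cap j ((1 : H) : G) s := (cap_one s).symm
    _ ≤ ∑ h : H, cap j h s :=
      single_le_sum (f := fun h : H => cap j h s) (fun h _ => hnonneg h) (mem_univ _)

theorem IsRamFun.exists_max_coset (hj : IsRamFun j) (H : Subgroup G) {g : G} (hg : g ∉ H) :
    ∃ h₀ ∈ H, j g ≤ j (g * h₀) ∧ ∀ h ∈ H, j (g * h₀ * h) = cap j h (j (g * h₀)) := by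
  obtain ⟨h₀, hh₀, hmax⟩ := Set.exists_max_image (H : Set G) (fun h => j (g * h)) (Set.toFinite _)
    ⟨1, H.one_mem⟩
  refine ⟨h₀, hh₀, by simpa using hmax 1 H.one_mem, fun h hh => ?_⟩
  refine hj.apply_mul_eq_cap (by rwa [H.mul_mem_cancel_right hh₀]) (fun h hh => ?_) hh
  rw [mul_assoc]
  exact hmax _ (H.mul_mem hh₀ hh)

theorem IsRamFun.exists_finsum_coset_eq_herbrandSum (hj : IsRamFun j) (H : Subgroup G) {g : G}
    (hg : g ∉ H) : ∃ h₀ ∈ H, j g ≤ j (g * h₀) ∧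
      ∑ᶠ h : H, j (g * h) = herbrandSum j H (j (g * h₀)) := by
  obtain ⟨h₀, hh₀, hle, hcap⟩ := hj.exists_max_coset H hg
  refine ⟨h₀, hh₀, hle, ?_⟩
  rw [← finsum_subgroup_mul_left hh₀ fun h => j (g * h)]
  simp only [← mul_assoc]
  exact finsum_congr fun h => hcap h h.2

theorem IsRamFun.finsum_coset_min (hj : IsRamFun j) (H : Subgroup G) {g : G} (hg : g ∉ H) (s : ℝ) :
    ∑ᶠ h : H, min (j (g * h)) s = min (∑ᶠ h : H, j (g * h)) (herbrandSum j H s) := by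
  obtain ⟨h₀, hh₀, -, hcap⟩ := hj.exists_max_coset H hg
  rw [← finsum_subgroup_mul_left hh₀ fun h => j (g * h),
    ← finsum_subgroup_mul_left hh₀ fun h => min (j (g * h)) s]
  simp only [← mul_assoc]
  rw [finsum_congr fun h : H => hcap h h.2, finsum_congr fun h : H => by rw [hcap h h.2, min_cap]]
  exact (herbrandSum_mono H).map_min

theorem IsRamFun.herbrandSum_le_finsum_coset (hj : IsRamFun j) (H : Subgroup G) {g : G}
    (hg : g ∉ H) : herbrandSum j H (j g) ≤ ∑ᶠ h : H, j (g * h) := by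
  obtain ⟨h₀, -, hle, heq⟩ := hj.exists_finsum_coset_eq_herbrandSum H hg
  exact heq ▸ herbrandSum_mono H hle

variable {H' H : Subgroup G}

theorem herbrandSum_eq_add_finsum_diff (hle : H' ≤ H) (s : ℝ) :
    herbrandSum j H s = herbrandSum j H' s + ∑ᶠ g ∈ (H \ H' : Set G), min (j g) s := by
  have hsum (S : Subgroup G) : herbrandSum j S s = ∑ᶠ g ∈ (S : Set G), cap j g s :=
    finsum_set_coe_eq_finsum_mem (f := fun g => cap j g s) (S : Set G)
  rw [hsum, hsum, ← finsum_mem_add_sdiff (show (H' : Set G) ⊆ H from hle) (Set.toFinite _)]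
  congr 1
  refine finsum_mem_congr rfl fun g hg => cap_of_ne_one ?_ s
  rintro rfl
  exact hg.2 (one_mem _)

/-- This replaces the transitivity of the Herbrand functions: the quotient `H / H'`, which is not
assumed to be a group, has the constant value `j₀` away from the identity coset. -/
theorem IsRamFun.herbrandSum_step (hj : IsRamFun j) (hle : H' ≤ H) {j₀ : ℝ}
    (hj₀ : ∀ g ∈ H, g ∉ H' → ∑ᶠ h : H', j (g * h) = j₀) (s : ℝ) :
    herbrandSum j H s =
      herbrandSum j H' s + ((H'.relIndex H : ℝ) - 1) * min j₀ (herbrandSum j H' s) := by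
  have := Fintype.ofFinite H'
  have hfin : (H \ H' : Set G).Finite := Set.toFinite _
  have hcard : (hfin.toFinset.card : ℝ) = ((H'.relIndex H : ℝ) - 1) * Nat.card H' := by
    rw [← Set.ncard_eq_toFinset_card _ hfin, sub_one_mul]
    have := Set.ncard_sdiff_add_ncard_of_subset (show (H' : Set G) ⊆ H from hle)
    rw [eq_sub_iff_add_eq]
    have hindex : H'.relIndex H * Nat.card H' = Nat.card H := by
      simpa [mul_comm] using Subgroup.relIndex_mul_relIndex ⊥ H' H bot_le hle
    exact_mod_cast this.trans hindex.symm
  have hcosets : (Nat.card H' : ℝ) * ∑ g ∈ hfin.toFinset, min (j g) s =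
      hfin.toFinset.card * min j₀ (herbrandSum j H' s) := by
    rw [← sum_sum_mul_eq_card_mul_sum H' _ fun g => min (j g) s, ← nsmul_eq_mul, ← sum_const]
    · refine sum_congr rfl fun g hg => ?_
      obtain ⟨hgH, hgH'⟩ := hfin.mem_toFinset.1 hg
      rw [← finsum_eq_sum_of_fintype, hj.finsum_coset_min H' hgH' s, hj₀ g hgH hgH']
    · intro g hg h hh
      simpa [H.mul_mem_cancel_right (hle hh), H'.mul_mem_cancel_right hh] using hg
  have hpos : (0 : ℝ) < Nat.card H' := by exact_mod_cast Nat.card_pos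
  rw [herbrandSum_eq_add_finsum_diff hle, finsum_mem_eq_finite_toFinset_sum _ hfin]
  congr 1
  refine mul_left_cancel₀ hpos.ne' ?_
  rw [hcosets, hcard]
  ring

end RamificationFunction

section TotallyRamified

open Module IsLocalRing

/-- `w` is a discrete valuation of `N`, invariant under the automorphisms over `F`, for which all
intermediate fields `M` are totally ramified over `F`; `e` is the value of a uniformizer of `F`, so
that the uniformizers of `M` have the value `e / [M : F]`. -/
structure IsTotallyRamified (F N : Type*) [Field F] [Field N] [Algebra F N]
    (w : AddValuation N (WithTop ℝ)) (e : ℝ) : Prop where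
  pos : 0 < e
  map_apply : ∀ (g : N ≃ₐ[F] N) (x : N), w (g x) = w x
  exists_int : ∀ (M : IntermediateField F N), ∀ x ∈ M, x ≠ 0 →
    ∃ z : ℤ, w x = ((z * (e / finrank F M) : ℝ) : WithTop ℝ)
  exists_uniformizer : ∀ M : IntermediateField F N,
    ∃ x ∈ M, w x = ((e / finrank F M : ℝ) : WithTop ℝ)
  exists_residue : ∀ x : N, 0 ≤ w x → ∃ a : F, 0 < w (x - algebraMap F N a)

theorem isTotallyRamified_extVal (A : Type*) [CommRing A] [IsDomain A] [IsDiscreteValuationRing A]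
    [IsAdicComplete (maximalIdeal A) A] [IsAlgClosed (ResidueField A)]
    (K : Type*) [Field K] [Algebra A K] [IsFractionRing A K]
    (F N : Type*) [Field F] [Field N] [Algebra K F] [Algebra A F] [Algebra F N] [Algebra K N]
    [Algebra A N] [IsScalarTower A K N] [IsScalarTower K F N] [IsScalarTower A F N]
    [FiniteDimensional K N] [Algebra.IsSeparable K N] :
    IsTotallyRamified F N (extVal A K N) (finrank K F : ℝ)⁻¹ := by
  have (M : IntermediateField F N) : IsScalarTower A K M :=
    IsScalarTower.of_algebraMap_eq fun a => Subtype.ext (IsScalarTower.algebraMap_apply A K N a)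
  have (M : IntermediateField F N) : FiniteDimensional K M := FiniteDimensional.left K M N
  have (M : IntermediateField F N) : Algebra.IsSeparable K M :=
    Algebra.isSeparable_tower_bot_of_isSeparable K M N
  have : FiniteDimensional K F := FiniteDimensional.left K F N
  have hdeg (M : IntermediateField F N) :
      (finrank K F : ℝ)⁻¹ / finrank F M = (finrank K M : ℝ)⁻¹ := by
    rw [← finrank_mul_finrank K F M, Nat.cast_mul, mul_inv, div_eq_mul_inv]
  have hval (M : IntermediateField F N) (x : M) : extVal A K N x = extVal A K M x :=
    extVal_map A K (IsScalarTower.toAlgHom A M N) x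
  refine ⟨inv_finrank_pos K F, fun g x => ?_, fun M x hx hx0 => ?_, fun M => ?_, fun x hx => ?_⟩
  · exact extVal_map A K (g.restrictScalars A).toAlgHom x
  · obtain ⟨n, hn⟩ := exists_extVal_eq A K (x := (⟨x, hx⟩ : M))
      fun hx' => hx0 (congrArg Subtype.val hx')
    exact ⟨n, by rw [hdeg, ← hn, ← hval]⟩
  · obtain ⟨x, hx⟩ := exists_extVal_eq_inv_finrank A K M
    exact ⟨x, x.2, by rw [hdeg, ← hx, ← hval]⟩
  · obtain ⟨a, ha⟩ := exists_pos_extVal_sub A K hx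
    exact ⟨algebraMap A F a, by rwa [← IsScalarTower.algebraMap_apply]⟩

variable {F N : Type*} [Field F] [Field N] [Algebra F N]
  {w : AddValuation N (WithTop ℝ)} {e : ℝ}

theorem exists_valuation_eq_coe (w : AddValuation N (WithTop ℝ)) {x : N} (hx : x ≠ 0) :
    ∃ r : ℝ, w x = r := by
  obtain ⟨r, hr⟩ := WithTop.ne_top_iff_exists.1 ((AddValuation.ne_top_iff w).2 hx)
  exact ⟨r, hr.symm⟩

theorem valuation_nonneg_or_inv_nonneg (w : AddValuation N (WithTop ℝ)) (x : N) :
    0 ≤ w x ∨ 0 ≤ w x⁻¹ := by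
  rcases eq_or_ne x 0 with rfl | hx
  · simp
  obtain ⟨r, hr⟩ := exists_valuation_eq_coe w hx
  rw [w.map_inv, hr]
  norm_cast
  exact (le_total 0 r).imp_right neg_nonneg.2

namespace IsTotallyRamified

variable [FiniteDimensional F N] (h : IsTotallyRamified F N w e) {M : IntermediateField F N}

include h

theorem div_pos (M : IntermediateField F N) : 0 < e / finrank F M :=
  _root_.div_pos h.pos (by exact_mod_cast finrank_pos)

theorem le_of_pos {x : N} (hx : x ∈ M) (hpos : 0 < w x) :
    ((e / finrank F M : ℝ) : WithTop ℝ) ≤ w x := by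
  rcases eq_or_ne x 0 with rfl | hx0
  · simp
  obtain ⟨z, hz⟩ := h.exists_int M x hx hx0
  rw [hz] at hpos ⊢
  have hz_pos : 0 < z := by
    exact_mod_cast (pos_iff_pos_of_mul_pos (WithTop.coe_pos.1 hpos)).2 (h.div_pos M)
  exact WithTop.coe_le_coe.2 (le_mul_of_one_le_left (h.div_pos M).le (by exact_mod_cast hz_pos))

variable {π : N} (hπM : π ∈ M) (hπ : w π = ((e / finrank F M : ℝ) : WithTop ℝ))

include hπM hπ

theorem exists_eq_algebraMap_add_mul {x : N} (hx : x ∈ M) (hx0 : 0 ≤ w x) :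
    ∃ a : F, ∃ y ∈ M, 0 ≤ w y ∧ x = algebraMap F N a + π * y := by
  have hπ0 : π ≠ 0 := by
    rintro rfl
    simp at hπ
  obtain ⟨a, ha⟩ := h.exists_residue x hx0
  have hxa : x - algebraMap F N a ∈ M := M.sub_mem hx (M.algebraMap_mem a)
  refine ⟨a, (x - algebraMap F N a) / π, M.div_mem hxa hπM, ?_, by field_simp; ring⟩
  have hdiv : w π + w ((x - algebraMap F N a) / π) = w (x - algebraMap F N a) := by
    rw [← AddValuation.map_mul, mul_div_cancel₀ _ hπ0]
  have hle : w π ≤ w π + w ((x - algebraMap F N a) / π) := by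
    rw [hdiv, hπ]
    exact h.le_of_pos hxa ha
  rw [hπ] at hle
  exact (WithTop.add_le_add_iff_left WithTop.coe_ne_top).1 (by simpa using hle)

theorem min_le_map_sub (g : N ≃ₐ[F] N) (n : ℕ) {x : N} (hx : x ∈ M) (hx0 : 0 ≤ w x) :
    min (w (g π - π)) (n • w π) ≤ w (g x - x) := by
  induction n generalizing x with
  | zero =>
    refine (min_le_right _ _).trans ?_
    rw [zero_smul]
    exact w.map_le_sub (by rwa [h.map_apply]) hx0
  | succ n ih =>
    obtain ⟨a, y, hy, hy0, rfl⟩ := h.exists_eq_algebraMap_add_mul hπM hπ hx hx0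
    have hπ_nonneg : 0 ≤ w π := by
      rw [hπ]
      exact_mod_cast (h.div_pos M).le
    have hsub : g (algebraMap F N a + π * y) - (algebraMap F N a + π * y) =
        (g π - π) * g y + π * (g y - y) := by
      rw [map_add, map_mul, g.commutes]
      ring
    rw [hsub]
    refine w.map_le_add ?_ ?_
    · rw [AddValuation.map_mul, h.map_apply]
      exact (min_le_left _ _).trans (le_add_of_nonneg_right hy0)
    · rw [AddValuation.map_mul]
      calc min (w (g π - π)) ((n + 1) • w π)
          ≤ min (w π + w (g π - π)) (w π + n • w π) := by
            rw [succ_nsmul']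
            exact min_le_min_right _ (le_add_of_nonneg_left hπ_nonneg)
        _ = w π + min (w (g π - π)) (n • w π) := min_add_add_left _ _ _
        _ ≤ w π + w (g y - y) := by gcongr; exact ih hy hy0

theorem le_map_sub (g : N ≃ₐ[F] N) {x : N} (hx : x ∈ M) (hx0 : 0 ≤ w x) :
    w (g π - π) ≤ w (g x - x) := by
  rcases eq_or_ne (g x - x) 0 with hgx | hgx
  · simp [hgx]
  obtain ⟨r, hr⟩ := exists_valuation_eq_coe w hgx
  obtain ⟨n, hn⟩ := exists_nat_gt (r / (e / finrank F M))
  rw [div_lt_iff₀ (h.div_pos M)] at hn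
  refine (min_le_iff.1 (h.min_le_map_sub hπM hπ g n hx hx0)).resolve_right (not_le.2 ?_)
  rw [hr, hπ, ← WithTop.coe_nsmul, nsmul_eq_mul]
  exact_mod_cast hn

theorem map_sub_eq {π' : N} (hπM' : π' ∈ M) (hπ' : w π' = ((e / finrank F M : ℝ) : WithTop ℝ))
    (g : N ≃ₐ[F] N) : w (g π - π) = w (g π' - π') := by
  have hnonneg : (0 : WithTop ℝ) ≤ ((e / finrank F M : ℝ) : WithTop ℝ) := by
    exact_mod_cast (h.div_pos M).le
  exact le_antisymm (h.le_map_sub hπM hπ g hπM' (hπ' ▸ hnonneg))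
    (h.le_map_sub hπM' hπ' g hπM (hπ ▸ hnonneg))

theorem mem_fixingSubgroup_iff (g : N ≃ₐ[F] N) : g ∈ M.fixingSubgroup ↔ g π = π := by
  rw [IntermediateField.mem_fixingSubgroup_iff]
  refine ⟨fun hg => hg π hπM, fun hg x hx => ?_⟩
  have hfix {y : N} (hy : y ∈ M) (hy0 : 0 ≤ w y) : g y = y := by
    have := h.le_map_sub hπM hπ g hy hy0
    rw [hg, sub_self, AddValuation.map_zero, top_le_iff, AddValuation.top_iff] at this
    exact sub_eq_zero.1 this
  rcases valuation_nonneg_or_inv_nonneg w x with hx0 | hx0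
  · exact hfix hx hx0
  · exact inv_injective (map_inv₀ g x ▸ hfix (M.inv_mem hx) hx0)

end IsTotallyRamified

end TotallyRamified

section UniformizerMovement

open Module Polynomial

section Polynomial

variable {N : Type*} [Field N] (w : AddValuation N (WithTop ℝ))

theorem map_finprod_of_forall_eq_coe {ι : Type*} [Finite ι] {f : ι → N} {r : ι → ℝ}
    (h : ∀ i, w (f i) = r i) : w (∏ᶠ i, f i) = ((∑ᶠ i, r i : ℝ) : WithTop ℝ) := by
  have := Fintype.ofFinite ι
  rw [finprod_eq_prod_of_fintype, finsum_eq_sum_of_fintype, valuation_prod, WithTop.coe_sum]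
  exact Finset.sum_congr rfl fun i _ => h i

theorem valuation_coeff_prod_X_sub_C_nonneg {ι : Type*} (s : Finset ι) {f : ι → N}
    (hf : ∀ i ∈ s, 0 ≤ w (f i)) (n : ℕ) : 0 ≤ w ((∏ i ∈ s, (X - C (f i))).coeff n) := by
  refine Finset.prod_induction (fun i => X - C (f i)) (fun P => ∀ n, 0 ≤ w (P.coeff n))
    (fun P Q hP hQ n => ?_) (fun n => ?_) (fun i hi n => ?_) n
  · rw [coeff_mul]
    refine w.map_le_sum fun i _ => ?_
    rw [AddValuation.map_mul]
    exact add_nonneg (hP _) (hQ _)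
  · rw [coeff_one]
    split_ifs <;> simp
  · rw [coeff_sub, coeff_X, coeff_C]
    refine w.map_le_sub ?_ ?_
    · split_ifs <;> simp
    · split_ifs
      · exact hf i hi
      · simp

variable {w}

theorem le_valuation_eval {v : WithTop ℝ} {P : N[X]} (hP : ∀ n, v ≤ w (P.coeff n)) {x : N}
    (hx : 0 ≤ w x) : v ≤ w (P.eval x) := by
  rw [eval_eq_sum_range]
  refine w.map_le_sum fun i _ => ?_
  rw [AddValuation.map_mul, AddValuation.map_pow]
  exact (hP i).trans (le_add_of_nonneg_right (nsmul_nonneg hx _))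

theorem valuation_eval_eq_coeff_zero {P : N[X]} (hP : ∀ n, w (P.coeff 0) ≤ w (P.coeff n)) {x : N}
    (hx : 0 < w x) : w (P.eval x) = w (P.coeff 0) := by
  rcases eq_or_ne (P.coeff 0) 0 with h0 | h0
  · rw [h0, AddValuation.map_zero]
    exact top_le_iff.1 (le_valuation_eval (fun n => by simpa [h0] using hP n) hx.le)
  have hle : w (P.coeff 0) ≤ w (P.divX.eval x) :=
    le_valuation_eval (fun n => by simpa only [coeff_divX] using hP (n + 1)) hx.le
  have heval : P.eval x = P.coeff 0 + P.divX.eval x * x := by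
    conv_lhs => rw [← divX_mul_X_add P, eval_add, eval_mul, eval_X, eval_C, add_comm]
  rw [heval]
  refine w.map_add_eq_of_lt_left ?_
  rw [AddValuation.map_mul]
  calc w (P.coeff 0) < w (P.coeff 0) + w x := by
        simpa using WithTop.add_lt_add_left ((AddValuation.ne_top_iff w).2 h0) hx
    _ ≤ w (P.divX.eval x) + w x := by gcongr

end Polynomial

variable {F N : Type*} [Field F] [Field N] [Algebra F N] {w : AddValuation N (WithTop ℝ)} {e : ℝ}

theorem charpoly_fixingSubgroup_coeff_mem [FiniteDimensional F N] [IsGalois F N]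
    (M : IntermediateField F N) [Fintype M.fixingSubgroup] (x : N) (n : ℕ) :
    (MulSemiringAction.charpoly M.fixingSubgroup x).coeff n ∈ M := by
  have hfix : (MulSemiringAction.charpoly M.fixingSubgroup x).coeff n ∈
      IntermediateField.fixedField M.fixingSubgroup :=
    fun g => MulSemiringAction.smul_coeff_charpoly x n g
  rwa [IsGalois.fixedField_fixingSubgroup] at hfix

/-- The function `g ↦ w (g π - π)` on the automorphism group, for `π` a uniformizer of `N`. It has
the junk value `0` at the elements fixing `π`. -/
def ramFun (w : AddValuation N (WithTop ℝ)) (π : N) (g : N ≃ₐ[F] N) : ℝ := (w (g π - π)).untopD 0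

namespace IsTotallyRamified

variable [FiniteDimensional F N] (h : IsTotallyRamified F N w e) {π : N}
  (hπ : w π = ((e / finrank F (⊤ : IntermediateField F N) : ℝ) : WithTop ℝ))

include h hπ

theorem apply_ne {g : N ≃ₐ[F] N} (hg : g ≠ 1) : g π ≠ π := fun hgπ => hg <| by
  simpa using (h.mem_fixingSubgroup_iff (M := ⊤) trivial hπ g).2 hgπ

theorem map_sub_eq_ramFun {g : N ≃ₐ[F] N} (hg : g ≠ 1) : w (g π - π) = (ramFun w π g : ℝ) := by
  obtain ⟨r, hr⟩ := exists_valuation_eq_coe w (sub_ne_zero.2 (h.apply_ne hπ hg))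
  rw [ramFun, hr, WithTop.untopD_coe]

theorem div_finrank_le_ramFun {g : N ≃ₐ[F] N} (hg : g ≠ 1) :
    e / finrank F (⊤ : IntermediateField F N) ≤ ramFun w π g := by
  rw [← WithTop.coe_le_coe, ← h.map_sub_eq_ramFun hπ hg, ← hπ]
  exact w.map_le_sub (h.map_apply g π).ge le_rfl

theorem isRamFun : IsRamFun (ramFun (F := F) w π) := by
  refine ⟨fun g g' hg hg' hgg' => ?_, fun g => ?_, fun g x => ?_⟩
  · rw [← WithTop.coe_le_coe, WithTop.coe_min, ← h.map_sub_eq_ramFun hπ hg,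
      ← h.map_sub_eq_ramFun hπ hg', ← h.map_sub_eq_ramFun hπ hgg']
    have hcocycle : (g * g') π - π = (g π - π) + g (g' π - π) := by
      rw [map_sub, AlgEquiv.mul_apply]
      ring
    rw [hcocycle, ← h.map_apply g (g' π - π)]
    exact w.map_add _ _
  · have hinv : g (g⁻¹ π - π) = π - g π := by
      rw [map_sub, ← AlgEquiv.mul_apply, mul_inv_cancel, AlgEquiv.one_apply]
    rw [ramFun, ramFun, ← h.map_apply g, hinv, w.map_sub_swap]
  · have hconj : (x * g * x⁻¹) π - π = x (g (x⁻¹ π) - x⁻¹ π) := by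
      rw [map_sub, ← AlgEquiv.mul_apply x x⁻¹, mul_inv_cancel]
      rfl
    rw [ramFun, ramFun, hconj, h.map_apply]
    congr 1
    exact h.map_sub_eq (M := ⊤) trivial (by rw [h.map_apply, hπ]) trivial hπ g

theorem valuation_charpoly_coeff_nonneg (H : Subgroup (N ≃ₐ[F] N)) [Fintype H] (n : ℕ) :
    0 ≤ w ((MulSemiringAction.charpoly H π).coeff n) := by
  refine valuation_coeff_prod_X_sub_C_nonneg w _ (fun g _ => ?_) n
  rw [show g • π = (g : N ≃ₐ[F] N) π from rfl, h.map_apply, hπ]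
  exact_mod_cast (h.div_pos ⊤).le

variable [IsGalois F N]

theorem valuation_charpoly_coeff_zero (M : IntermediateField F N) [Fintype M.fixingSubgroup] :
    w ((MulSemiringAction.charpoly M.fixingSubgroup π).coeff 0) =
      ((e / finrank F M : ℝ) : WithTop ℝ) := by
  have hdeg : (finrank F M : ℝ) * finrank M N = finrank F N := by
    exact_mod_cast finrank_mul_finrank F M N
  have hF : (finrank F M : ℝ) ≠ 0 := by exact_mod_cast finrank_pos.ne'
  have hM : (finrank M N : ℝ) ≠ 0 := by exact_mod_cast finrank_pos.ne'
  rw [coeff_zero_eq_eval_zero, MulSemiringAction.charpoly_eq, eval_prod,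
    ← finprod_eq_prod_of_fintype,
    map_finprod_of_forall_eq_coe w (r := fun _ => e / finrank F (⊤ : IntermediateField F N))]
  · rw [finsum_eq_sum_of_fintype, Finset.sum_const, nsmul_eq_mul, Finset.card_univ,
      ← Nat.card_eq_fintype_card, IsGalois.card_fixingSubgroup_eq_finrank,
      IntermediateField.finrank_top', ← hdeg]
    congr 1
    field_simp
  · intro g
    rw [eval_sub, eval_X, eval_C, zero_sub, w.map_neg]
    exact (h.map_apply g π).trans hπ

/-- The coefficients of the minimal polynomial `P` of `π` over `M` are integers of `M`, and its
constant coefficient is a uniformizer of `M`. Hence `g P - P` has its least valuation in degree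
`0`; evaluate it at `π`. -/
theorem map_sub_eq_finsum {M : IntermediateField F N} {ϖ : N} (hϖM : ϖ ∈ M)
    (hϖ : w ϖ = ((e / finrank F M : ℝ) : WithTop ℝ)) {g : N ≃ₐ[F] N} (hg : g ∉ M.fixingSubgroup) :
    w (g ϖ - ϖ) =
      ((∑ᶠ x : M.fixingSubgroup, ramFun w π (g * (x : N ≃ₐ[F] N)) : ℝ) : WithTop ℝ) := by
  have := Fintype.ofFinite M.fixingSubgroup
  set P := MulSemiringAction.charpoly M.fixingSubgroup π with hP
  have hcoeff_mem (n : ℕ) : P.coeff n ∈ M := charpoly_fixingSubgroup_coeff_mem M π n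
  have hcoeff (n : ℕ) : (P.map (g : N →+* N) - P).coeff n = g (P.coeff n) - P.coeff n := by simp
  have hcoeff_zero : w ((P.map (g : N →+* N) - P).coeff 0) = w (g ϖ - ϖ) := by
    rw [hcoeff]
    exact h.map_sub_eq (hcoeff_mem 0) (h.valuation_charpoly_coeff_zero hπ M) hϖM hϖ g
  have heval : (P.map (g : N →+* N) - P).eval π =
      ∏ᶠ x : M.fixingSubgroup, (π - (g * (x : N ≃ₐ[F] N)) π) := by
    rw [eval_sub, hP, MulSemiringAction.eval_charpoly, sub_zero, MulSemiringAction.charpoly_eq,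
      Polynomial.map_prod, eval_prod, finprod_eq_prod_of_fintype]
    refine Finset.prod_congr rfl fun x _ => ?_
    simp only [Polynomial.map_sub, map_X, map_C, eval_sub, eval_X, eval_C]
    rfl
  rw [← hcoeff_zero, ← valuation_eval_eq_coeff_zero (fun n => ?_) (x := π), heval]
  · refine map_finprod_of_forall_eq_coe w fun x => ?_
    rw [w.map_sub_swap]
    refine h.map_sub_eq_ramFun hπ fun hgx => hg ?_
    exact eq_inv_of_mul_eq_one_left hgx ▸ M.fixingSubgroup.inv_mem x.2
  · rw [hπ]
    exact_mod_cast h.div_pos ⊤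
  · rw [hcoeff_zero, hcoeff]
    exact h.le_map_sub hϖM hϖ g (hcoeff_mem n) (h.valuation_charpoly_coeff_nonneg hπ _ n)

end IsTotallyRamified

end UniformizerMovement

section RamificationConductor

open Module MeasureTheory

theorem intervalIntegral_indicator_Iic {c u : ℝ} (hc : 0 ≤ c) (hu : 0 ≤ u) :
    ∫ t in (0 : ℝ)..u, (Set.Iic c).indicator (fun _ => (1 : ℝ)) t = min c u := by
  rw [intervalIntegral.integral_of_le hu, integral_indicator measurableSet_Iic,
    Measure.restrict_restrict measurableSet_Iic, Set.inter_comm, Set.Ioc_inter_Iic, min_comm]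
  simp [le_min hc hu]

theorem lowerGroup_antitone {A : Type*} [CommRing A] {F N : Type*} [Field F] [Field N] [Algebra A N]
    [Algebra F N] : Antitone (lowerGroup A N F) := fun _ _ hst _ hg π hπ =>
  (WithTop.coe_le_coe.2 (add_le_add_left hst 1)).trans (hg π hπ)

namespace IsTotallyRamified

variable {A : Type*} [CommRing A] {F N : Type*} [Field F] [Field N] [Algebra A N] [Algebra F N]
  [IsDiscreteValuationRing (integralClosure A N)]
  {w : AddValuation N (WithTop ℝ)} {e : ℝ}
  (hord : ∀ x, w x =
    (ord A N x).map fun n : ℤ => (n : ℝ) * (e / finrank F (⊤ : IntermediateField F N)))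
  {π : N} (hπ : IsUniformizer A N π)

include hord hπ

theorem valuation_uniformizer :
    w π = ((e / finrank F (⊤ : IntermediateField F N) : ℝ) : WithTop ℝ) := by
  rw [hord, hπ.ord_eq]
  simp

variable [FiniteDimensional F N] (h : IsTotallyRamified F N w e)

include h

theorem mem_lowerGroup_iff (i : ℝ) (g : N ≃ₐ[F] N) :
    g ∈ lowerGroup A N F i ↔
      g = 1 ∨ e / finrank F (⊤ : IntermediateField F N) * (i + 1) ≤ ramFun w π g := by
  have hle_iff (x : N) : ((i + 1 : ℝ) : WithTop ℝ) ≤ (ord A N x).map (fun n : ℤ => (n : ℝ)) ↔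
      ((e / finrank F (⊤ : IntermediateField F N) * (i + 1) : ℝ) : WithTop ℝ) ≤ w x := by
    rw [hord]
    cases ord A N x with
    | top => simp
    | coe n =>
      rw [WithTop.map_coe, WithTop.map_coe, WithTop.coe_le_coe, WithTop.coe_le_coe, mul_comm,
        mul_le_mul_iff_left₀ (h.div_pos ⊤)]
  have hmem : g ∈ lowerGroup A N F i ↔
      ((e / finrank F (⊤ : IntermediateField F N) * (i + 1) : ℝ) : WithTop ℝ) ≤ w (g π - π) := by
    simp only [lowerGroup, Set.mem_ofPred_eq, hle_iff]
    refine ⟨fun hg => hg π hπ, fun hg π' hπ' => ?_⟩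
    rwa [h.map_sub_eq (M := ⊤) trivial (valuation_uniformizer hord hπ') trivial
      (valuation_uniformizer hord hπ)]
  rw [hmem]
  rcases eq_or_ne g 1 with rfl | hg
  · simp
  · rw [h.map_sub_eq_ramFun (valuation_uniformizer hord hπ) hg, WithTop.coe_le_coe]
    simp [hg]

theorem lowerGroup_zero : lowerGroup A N F 0 = Set.univ := by
  refine Set.eq_univ_of_forall fun g => (h.mem_lowerGroup_iff hord hπ 0 g).2 ?_
  refine or_iff_not_imp_left.2 fun hg => ?_
  simpa using h.div_finrank_le_ramFun (valuation_uniformizer hord hπ) hg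

theorem lowerGroup_ne_singleton_one_iff {g₀ : N ≃ₐ[F] N} (hg₀ : g₀ ≠ 1)
    (hmax : ∀ g : N ≃ₐ[F] N, g ≠ 1 → ramFun w π g ≤ ramFun w π g₀) (u : ℝ) :
    lowerGroup A N F u ≠ {1} ↔
      e / finrank F (⊤ : IntermediateField F N) * (u + 1) ≤ ramFun w π g₀ := by
  have hmem := h.mem_lowerGroup_iff hord hπ u
  refine ⟨fun hne => ?_, fun hle heq => hg₀ (heq.subset ((hmem g₀).2 (Or.inr hle)))⟩
  contrapose! hne
  refine Set.eq_singleton_iff_unique_mem.2 ⟨(hmem 1).2 (Or.inl rfl), fun g hg => ?_⟩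
  by_contra hg1
  exact (((hmem g).1 hg).resolve_left hg1).not_gt ((hmax g hg1).trans_lt hne)

theorem intervalIntegral_indicator_mem_lowerGroup (g : N ≃ₐ[F] N) {u : ℝ} (hu : 0 ≤ u) :
    ∫ t in (0 : ℝ)..u, {t | g ∈ lowerGroup A N F t}.indicator (fun _ => (1 : ℝ)) t =
      cap (ramFun w π) g (e / finrank F (⊤ : IntermediateField F N) * (u + 1)) /
        (e / finrank F (⊤ : IntermediateField F N)) - 1 := by
  have hε := h.div_pos (⊤ : IntermediateField F N)
  have hε_le (hg : g ≠ 1) := h.div_finrank_le_ramFun (valuation_uniformizer hord hπ) hg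
  set ε := e / finrank F (⊤ : IntermediateField F N)
  rcases eq_or_ne g 1 with rfl | hg
  · have huniv : {t | 1 ∈ lowerGroup A N F t} = Set.univ :=
      Set.eq_univ_of_forall fun t => (h.mem_lowerGroup_iff hord hπ t 1).2 (Or.inl rfl)
    rw [huniv, cap_one, mul_div_cancel_left₀ _ hε.ne']
    simp
  · have hIic : {t | g ∈ lowerGroup A N F t} = Set.Iic (ramFun w π g / ε - 1) := by
      ext t
      rw [Set.mem_ofPred_eq, h.mem_lowerGroup_iff hord hπ, Set.mem_Iic, le_sub_iff_add_le,
        le_div_iff₀ hε, mul_comm, or_iff_right hg]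
    have hnonneg : 0 ≤ ramFun w π g / ε - 1 := by
      rw [sub_nonneg, le_div_iff₀ hε, one_mul]
      exact hε_le hg
    rw [hIic, intervalIntegral_indicator_Iic hnonneg hu, cap_of_ne_one hg,
      ← min_div_div_right hε.le, ← min_sub_sub_right, mul_div_cancel_left₀ _ hε.ne',
      add_sub_cancel_right]

variable [IsGalois F N]

theorem herbrandPhi_eq {u : ℝ} (hu : 0 ≤ u) :
    herbrandPhi A N F u =
      herbrandSum (ramFun (F := F) w π) ⊤
        (e / finrank F (⊤ : IntermediateField F N) * (u + 1)) / e - 1 := by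
  have he := h.pos
  have hintegral := fun g => h.intervalIntegral_indicator_mem_lowerGroup hord hπ g hu
  have hn : (0 : ℝ) < finrank F (⊤ : IntermediateField F N) := by exact_mod_cast finrank_pos
  have hcardG : (Fintype.card (N ≃ₐ[F] N) : ℝ) = finrank F (⊤ : IntermediateField F N) := by
    rw [← Nat.card_eq_fintype_card, IsGalois.card_aut_eq_finrank, IntermediateField.finrank_top']
  have hcard (t : ℝ) : ((lowerGroup A N F t).ncard : ℝ) =
      ∑ g : N ≃ₐ[F] N, {t | g ∈ lowerGroup A N F t}.indicator (fun _ => (1 : ℝ)) t := by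
    classical
    rw [Set.ncard_eq_toFinset_card', ← Set.filter_mem_univ_eq_toFinset, Finset.card_filter]
    push_cast
    exact Finset.sum_congr rfl fun g _ =>
      (Set.indicator_apply {t | g ∈ lowerGroup A N F t} (fun _ => (1 : ℝ)) t).symm
  have hint (g : N ≃ₐ[F] N) : IntervalIntegrable
      ({t | g ∈ lowerGroup A N F t}.indicator fun _ => (1 : ℝ)) volume 0 u := by
    refine Antitone.intervalIntegrable fun s t hst => ?_
    classical
    rw [Set.indicator_apply, Set.indicator_apply]
    split_ifs with ht hs
    · exact le_rfl
    · exact absurd (lowerGroup_antitone hst ht) hs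
    · exact zero_le_one
    · exact le_rfl
  rw [herbrandPhi, intervalIntegral.integral_div, h.lowerGroup_zero hord hπ, Set.ncard_univ,
    Nat.card_eq_fintype_card, hcardG]
  simp only [hcard]
  rw [intervalIntegral.integral_finsetSum fun g _ => hint g, Finset.sum_congr rfl fun g _ =>
    hintegral g, Finset.sum_sub_distrib, ← Finset.sum_div, herbrandSum_top,
    finsum_eq_sum_of_fintype, Finset.sum_const, Finset.card_univ, nsmul_one, hcardG]
  field_simp

theorem surjOn_herbrandPhi : Set.SurjOn (herbrandPhi A N F) (Set.Ici 0) (Set.Ici 0) := by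
  intro v hv
  have he := h.pos
  have hε := h.div_pos (⊤ : IntermediateField F N)
  have hphi := fun {u : ℝ} => h.herbrandPhi_eq hord hπ (u := u)
  have hε_le {g : N ≃ₐ[F] N} := h.div_finrank_le_ramFun (valuation_uniformizer hord hπ) (g := g)
  set ε := e / finrank F (⊤ : IntermediateField F N)
  rw [Set.mem_Ici] at hv
  have hU : 0 ≤ (v + 1) * e / ε := by positivity
  have hcont : ContinuousOn (herbrandPhi A N F) (Set.Icc 0 ((v + 1) * e / ε)) := by
    have := continuous_herbrandSum (j := ramFun (F := F) w π) ⊤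
    exact ContinuousOn.congr (by fun_prop) fun u hu => hphi hu.1
  have hbig : v ≤ herbrandPhi A N F ((v + 1) * e / ε) := by
    rw [hphi hU, le_sub_iff_add_le, le_div_iff₀ he]
    refine le_trans ?_ (le_herbrandSum (fun g _ hg => hε.le.trans (hε_le hg)) (by positivity))
    rw [mul_add, mul_div_cancel₀ _ hε.ne', mul_one]
    exact le_add_of_nonneg_right hε.le
  obtain ⟨u, hu, huv⟩ := intermediate_value_Icc hU hcont ⟨by simpa [herbrandPhi] using hv, hbig⟩
  exact ⟨u, hu.1, huv⟩

theorem ramConductor_eq {g₀ : N ≃ₐ[F] N} (hg₀ : g₀ ≠ 1)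
    (hmax : ∀ g : N ≃ₐ[F] N, g ≠ 1 → ramFun w π g ≤ ramFun w π g₀) :
    ramConductor A N F = herbrandSum (ramFun (F := F) w π) ⊤ (ramFun w π g₀) / e - 1 := by
  have hphi := fun {u : ℝ} => h.herbrandPhi_eq hord hπ (u := u)
  have hset : {i : ℝ | 0 ≤ i ∧ upperGroup A N F i ≠ {1}} =
      Set.Icc 0 (herbrandSum (ramFun (F := F) w π) ⊤ (ramFun w π g₀) / e - 1) := by
    ext i
    refine and_congr_right fun hi => ?_
    obtain ⟨hu : 0 ≤ herbrandPsi A N F i, hui : herbrandPhi A N F (herbrandPsi A N F i) = i⟩ :=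
      Function.invFunOn_pos (h.surjOn_herbrandPhi hord hπ hi)
    rw [upperGroup, h.lowerGroup_ne_singleton_one_iff hord hπ hg₀ hmax,
      ← (herbrandSum_strictMono (j := ramFun (F := F) w π) ⊤).le_iff_le]
    conv_rhs => rw [← hui]
    rw [hphi hu, sub_le_sub_iff_right, div_le_div_iff_of_pos_right h.pos]
  have hnonneg : 0 ≤ herbrandSum (ramFun (F := F) w π) ⊤ (ramFun w π g₀) / e - 1 := by
    have hzero : herbrandPhi A N F 0 = 0 := by simp [herbrandPhi]
    rw [← hzero, hphi le_rfl, sub_le_sub_iff_right, div_le_div_iff_of_pos_right h.pos]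
    refine herbrandSum_mono ⊤ ?_
    simpa using h.div_finrank_le_ramFun (valuation_uniformizer hord hπ) hg₀
  rw [ramConductor, hset, csSup_Icc hnonneg]

end IsTotallyRamified

end RamificationConductor

section KummerValuations

open Finset

theorem isPrimitiveRoot_of_pow_prime_eq_one {G : Type*} [CommMonoid G] {ζ : G} {p : ℕ}
    (hp : p.Prime) (hζ : ζ ^ p = 1) (hζ1 : ζ ≠ 1) : IsPrimitiveRoot ζ p := by
  have := Fact.mk hp
  exact orderOf_eq_prime hζ hζ1 ▸ IsPrimitiveRoot.orderOf ζ

variable {N : Type*} [Field N] {w : AddValuation N (WithTop ℝ)} {p : ℕ}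

theorem valuation_natCast_nonneg (w : AddValuation N (WithTop ℝ)) (n : ℕ) : 0 ≤ w (n : N) := by
  induction n with
  | zero => simp
  | succ n ih =>
    rw [Nat.cast_succ]
    exact w.map_le_add ih w.map_one.ge

theorem valuation_natCast_eq_zero (hp : p.Prime) (hwp : 0 < w (p : N)) {n : ℕ} (hn : ¬ p ∣ n) :
    w (n : N) = 0 := by
  refine le_antisymm (not_lt.1 fun hlt => ?_) (valuation_natCast_nonneg w n)
  have hint (z : ℤ) : 0 ≤ w (z : N) := by
    obtain ⟨m, rfl | rfl⟩ := z.eq_nat_or_neg <;> simpa using valuation_natCast_nonneg w m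
  obtain ⟨u, v, huv⟩ := Nat.isCoprime_iff_coprime.2 ((hp.coprime_iff_not_dvd).2 hn).symm
  have hpos : 0 < w ((u * n + v * p : ℤ) : N) := by
    push_cast
    rw [mul_comm, mul_comm (v : N)]
    refine w.map_lt_add ?_ ?_ <;> rw [w.map_mul]
    · exact add_pos_of_pos_of_nonneg hlt (hint u)
    · exact add_pos_of_pos_of_nonneg hwp (hint v)
  simp [huv] at hpos

theorem valuation_eq_zero_of_pow {n : ℕ} (hn : n ≠ 0) {x : N} (hx : w (x ^ n) = 0) : w x = 0 := by
  have hx0 : x ≠ 0 := by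
    rintro rfl
    simp [hn] at hx
  obtain ⟨r, hr⟩ := exists_valuation_eq_coe w hx0
  rw [valuation_pow_of_eq_coe w hr] at hx
  have : (n : ℝ) * r = 0 := by exact_mod_cast hx
  rw [hr, (mul_eq_zero.1 this).resolve_left (by exact_mod_cast hn), WithTop.coe_zero]

theorem valuation_eq_zero_of_sub_one_pos {x : N} (hx : 0 < w (x - 1)) : w x = 0 := by
  rw [← sub_add_cancel x 1, w.map_add_eq_of_lt_right (by rwa [w.map_one]), w.map_one]

theorem le_valuation_pow_sub_one {x : N} (hx : 0 ≤ w x) (n : ℕ) : w (x - 1) ≤ w (x ^ n - 1) := by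
  rw [← mul_geom_sum, w.map_mul]
  refine le_add_of_nonneg_right (w.map_le_sum fun i _ => ?_)
  rw [w.map_pow]
  exact nsmul_nonneg hx i

theorem valuation_pow_sub_one (hp : p.Prime) (hwp : 0 < w (p : N)) {x : N} (hx : 0 < w (x - 1))
    {n : ℕ} (hn : ¬ p ∣ n) : w (x ^ n - 1) = w (x - 1) := by
  have hn0 := valuation_natCast_eq_zero hp hwp hn
  have hsum : ∑ i ∈ range n, x ^ i = n + ∑ i ∈ range n, (x ^ i - 1) := by simp
  have hlt : 0 < w (∑ i ∈ range n, (x ^ i - 1)) := w.map_lt_sum (by simp) fun i _ =>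
    hx.trans_le (le_valuation_pow_sub_one (valuation_eq_zero_of_sub_one_pos hx).ge i)
  rw [← mul_geom_sum, w.map_mul, hsum, w.map_add_eq_of_lt_left (by rwa [hn0]), hn0, add_zero]

section PrimitiveRoot

variable {ζ : N}

theorem valuation_isPrimitiveRoot {n : ℕ} (hn : n ≠ 0) (hζ : IsPrimitiveRoot ζ n) : w ζ = 0 :=
  valuation_eq_zero_of_pow hn (by rw [hζ.pow_eq_one, w.map_one])

theorem valuation_isPrimitiveRoot_sub_one_eq {n : ℕ} (hn : n ≠ 0) {ζ' : N}
    (hζ : IsPrimitiveRoot ζ n) (hζ' : IsPrimitiveRoot ζ' n) : w (ζ - 1) = w (ζ' - 1) := by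
  have hle {ξ ξ' : N} (hξ : IsPrimitiveRoot ξ n) (hξ' : ξ' ^ n = 1) : w (ξ - 1) ≤ w (ξ' - 1) := by
    have := NeZero.mk hn
    obtain ⟨i, -, rfl⟩ := hξ.eq_pow_of_pow_eq_one hξ'
    exact le_valuation_pow_sub_one (valuation_isPrimitiveRoot hn hξ).ge i
  exact (hle hζ hζ'.pow_eq_one).antisymm (hle hζ' hζ.pow_eq_one)

variable (hp : p.Prime) (hwp : w (p : N) = 1) (hζ : IsPrimitiveRoot ζ p)

include hp hwp hζ

theorem valuation_isPrimitiveRoot_sub_one :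
    w (ζ - 1) = ((1 / ((p : ℝ) - 1) : ℝ) : WithTop ℝ) := by
  have hp1 : (p : ℝ) - 1 ≠ 0 := sub_ne_zero.2 (by exact_mod_cast hp.ne_one)
  obtain ⟨r, hr⟩ := exists_valuation_eq_coe w (sub_ne_zero.2 (hζ.ne_one hp.one_lt))
  have hfactor : ∀ k ∈ range (p - 1), w (1 - ζ ^ (k + 1)) = r := by
    intro k hk
    have hk : k + 1 < p := by
      have := mem_range.1 hk
      omega
    have hcop : (k + 1).Coprime p := (Nat.coprime_of_lt_prime k.succ_ne_zero hk hp).symm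
    rw [w.map_sub_swap, ← hr]
    exact valuation_isPrimitiveRoot_sub_one_eq hp.ne_zero (hζ.pow_of_coprime _ hcop) hζ
  have hprod := congrArg w
    (IsPrimitiveRoot.prod_one_sub_pow_eq_order (n := p - 1) (by rwa [Nat.sub_add_cancel hp.pos]))
  rw [valuation_prod, sum_congr rfl hfactor, sum_const, card_range, ← Nat.cast_succ,
    Nat.succ_eq_add_one, Nat.sub_add_cancel hp.pos, hwp, ← WithTop.coe_nsmul, nsmul_eq_mul,
    Nat.cast_pred hp.pos] at hprod
  rw [hr, WithTop.coe_inj, eq_div_iff hp1, mul_comm]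
  exact_mod_cast hprod

theorem valuation_sub_one_of_pow_sub_one {τ : ℝ} (hτ : τ < p / ((p : ℝ) - 1)) {b : N}
    (hb : w (b ^ p - 1) = τ) : w (b - 1) = ((τ / p : ℝ) : WithTop ℝ) := by
  have hp0 : (p : ℝ) ≠ 0 := by exact_mod_cast hp.ne_zero
  have hprod : ∑ η ∈ Polynomial.nthRootsFinset p (1 : N), w (b - η) = τ := by
    have := hζ.pow_sub_pow_eq_prod_sub_mul b 1 hp.pos
    simp only [one_pow, mul_one] at this
    rw [← hb, this, valuation_prod]
  have hη : ∀ η ∈ Polynomial.nthRootsFinset p (1 : N), η ≠ 1 →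
      w (η - 1) = ((1 / ((p : ℝ) - 1) : ℝ) : WithTop ℝ) := fun η hη hη1 =>
    valuation_isPrimitiveRoot_sub_one hp hwp
      (isPrimitiveRoot_of_pow_prime_eq_one hp
        ((Polynomial.mem_nthRootsFinset hp.pos 1).1 hη) hη1)
  have hsub (η : N) : b - η = (b - 1) - (η - 1) := by ring
  rcases le_or_gt ((1 / ((p : ℝ) - 1) : ℝ) : WithTop ℝ) (w (b - 1)) with hle | hlt
  · refine absurd hτ (not_lt.2 ?_)
    have := card_nsmul_le_sum (Polynomial.nthRootsFinset p (1 : N)) (fun η => w (b - η)) _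
      fun η hη' => show ((1 / ((p : ℝ) - 1) : ℝ) : WithTop ℝ) ≤ w (b - η) by
        rw [hsub]
        refine w.map_le_sub hle ?_
        rcases eq_or_ne η 1 with rfl | hη1
        · simp
        · exact (hη η hη' hη1).ge
    rw [hprod, hζ.card_nthRootsFinset, ← WithTop.coe_nsmul, nsmul_eq_mul, WithTop.coe_le_coe,
      mul_one_div] at this
    exact this
  · have hconst : ∀ η ∈ Polynomial.nthRootsFinset p (1 : N), w (b - η) = w (b - 1) := by
      intro η hη'
      rcases eq_or_ne η 1 with rfl | hη1
      · rfl
      · rw [hsub, w.map_sub_eq_of_lt_left (by rwa [hη η hη' hη1])]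
    rw [sum_congr rfl hconst, sum_const, hζ.card_nthRootsFinset] at hprod
    obtain ⟨r, hr⟩ := WithTop.ne_top_iff_exists.1 hlt.ne_top
    rw [← hr, ← WithTop.coe_nsmul, nsmul_eq_mul, WithTop.coe_inj] at hprod
    rw [← hr, WithTop.coe_inj, eq_div_iff hp0, mul_comm, hprod]

end PrimitiveRoot

/-- `a` is `p`-primitive for a field whose uniformizers have the value `ε`, and `a - 1` has the
value `n ε`: the counterpart of `IsPPrimitive` for the valuation with `w p = 1`, so that
`p / (p - 1)` takes the place of `e p / (p - 1)`. -/
structure IsPPrimitiveOfOrder (w : AddValuation N (WithTop ℝ)) (p : ℕ) (ε : ℝ) (a : N)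
    (n : ℤ) : Prop where
  map_sub_one : w (a - 1) = ((n * ε : ℝ) : WithTop ℝ)
  primitive : (∃ m : ℤ, w a = ((m * ε : ℝ) : WithTop ℝ) ∧ ¬ (p : ℤ) ∣ m ∧ 0 < m ∧ n = 0) ∨
    (0 < n ∧ n * ε < p / ((p : ℝ) - 1) ∧ ¬ (p : ℤ) ∣ n)

namespace IsPPrimitiveOfOrder

variable {ε : ℝ} {a b : N} {n : ℤ} (ha : IsPPrimitiveOfOrder w p ε a n)

include ha

theorem mul_lt (hp : p.Prime) : n * ε < p / ((p : ℝ) - 1) := by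
  rcases ha.primitive with ⟨-, -, -, -, rfl⟩ | ⟨-, h, -⟩
  · have : (1 : ℝ) < p := by exact_mod_cast hp.one_lt
    rw [Int.cast_zero, zero_mul]
    exact _root_.div_pos (by linarith) (by linarith)
  · exact h

theorem root (hp : p.Prime) (hwp : w (p : N) = 1) {ζ : N} (hζ : IsPrimitiveRoot ζ p) (hε : 0 < ε)
    (hb : b ^ p = a) : IsPPrimitiveOfOrder w p (ε / p) b n := by
  have hp0 : (0 : ℝ) < p := by exact_mod_cast hp.pos
  rcases ha.primitive with ⟨m, hm, hpm, hm0, rfl⟩ | ⟨hn0, hn1, hpn⟩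
  · have hb0 : b ≠ 0 := by
      rintro rfl
      simp only [← hb, zero_pow hp.ne_zero, w.map_zero, WithTop.top_ne_coe] at hm
    obtain ⟨r, hr⟩ := exists_valuation_eq_coe w hb0
    rw [← hb, valuation_pow_of_eq_coe w hr, WithTop.coe_inj] at hm
    have hwb : w b = ((m * (ε / p) : ℝ) : WithTop ℝ) := by
      rw [hr, WithTop.coe_inj, mul_div_assoc', eq_div_iff hp0.ne', mul_comm, hm]
    have hpos : 0 < w b := by
      have : (0 : ℝ) < m := by exact_mod_cast hm0
      rw [hwb]
      exact_mod_cast mul_pos this (_root_.div_pos hε hp0)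
    refine ⟨?_, .inl ⟨m, hwb, hpm, hm0, rfl⟩⟩
    rw [w.map_sub_eq_of_lt_right (by rwa [w.map_one])]
    simp
  · have hsub := ha.map_sub_one
    rw [← hb] at hsub
    refine ⟨?_, .inr ⟨hn0, lt_of_le_of_lt ?_ hn1, hpn⟩⟩
    · rw [valuation_sub_one_of_pow_sub_one hp hwp hζ hn1 hsub, mul_div_assoc]
    · gcongr
      exact div_le_self hε.le (by exact_mod_cast hp.one_lt.le)

theorem exists_order_not_dvd (hε : 0 < ε) :
    ∃ (z : N) (m : ℤ), (z = a ∨ z = a - 1) ∧ ¬ (p : ℤ) ∣ m ∧ w z = ((m * ε : ℝ) : WithTop ℝ) ∧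
      w z = w a + ((n * ε : ℝ) : WithTop ℝ) := by
  rcases ha.primitive with ⟨m, hm, hpm, -, rfl⟩ | ⟨hn0, -, hpn⟩
  · exact ⟨a, m, .inl rfl, hpm, hm, by simp⟩
  · refine ⟨a - 1, n, .inr rfl, hpn, ha.map_sub_one, ?_⟩
    have hpos : 0 < w (a - 1) := by
      have : (0 : ℝ) < n := by exact_mod_cast hn0
      rw [ha.map_sub_one]
      exact_mod_cast mul_pos this hε
    rw [valuation_eq_zero_of_sub_one_pos hpos, zero_add, ha.map_sub_one]

end IsPPrimitiveOfOrder

end KummerValuations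

section KummerTower

open Module Polynomial

open scoped IntermediateField

section Adjoin

variable {F N : Type*} [Field F] [Field N] [Algebra F N] {M : IntermediateField F N} {b : N}

theorem mem_sup_adjoin (M : IntermediateField F N) (b : N) : b ∈ M ⊔ F⟮b⟯ :=
  (le_sup_right : F⟮b⟯ ≤ M ⊔ F⟮b⟯) (IntermediateField.mem_adjoin_simple_self F b)

theorem sup_adjoin_pow_sup_adjoin (M : IntermediateField F N) (b : N) (n : ℕ) :
    M ⊔ F⟮b ^ n⟯ ⊔ F⟮b⟯ = M ⊔ F⟮b⟯ := by
  rw [sup_assoc, sup_eq_right (a := F⟮b ^ n⟯) |>.2]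
  exact IntermediateField.adjoin_simple_le_iff.2
    (pow_mem (IntermediateField.mem_adjoin_simple_self F b) n)

theorem mem_fixingSubgroup_sup_adjoin {g : N ≃ₐ[F] N} :
    g ∈ (M ⊔ F⟮b⟯).fixingSubgroup ↔ g ∈ M.fixingSubgroup ∧ g b = b := by
  rw [IntermediateField.fixingSubgroup_sup, Subgroup.mem_inf, and_congr_right_iff]
  intro _
  rw [← Subgroup.zpowers_le, ← IntermediateField.le_iff_le, IntermediateField.adjoin_simple_le_iff,
    IntermediateField.mem_fixedField_iff]
  refine ⟨fun h => h g (Subgroup.mem_zpowers g), fun h f hf => ?_⟩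
  have : Subgroup.zpowers g ≤ MulAction.stabilizer (N ≃ₐ[F] N) b := Subgroup.zpowers_le.2 h
  exact this hf

theorem exists_finrank_sup_adjoin_eq_mul [FiniteDimensional F N] {P : M[X]} (hP : P ≠ 0)
    (hPb : aeval b P = 0) :
    ∃ d, 0 < d ∧ d ≤ P.natDegree ∧ finrank F ↥(M ⊔ F⟮b⟯) = d * finrank F M := by
  refine ⟨finrank M M⟮b⟯, finrank_pos, ?_, ?_⟩
  · rw [IntermediateField.adjoin.finrank (IsIntegral.of_finite M b)]
    exact natDegree_le_of_dvd (minpoly.dvd M b hPb) hP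
  · rw [← IntermediateField.restrictScalars_adjoin_eq_sup, mul_comm]
    exact (finrank_mul_finrank F M M⟮b⟯).symm

end Adjoin

theorem exists_nat_mul_add_int_mul_eq_one {p : ℕ} (hp : p.Prime) {m : ℤ} (hm : ¬ (p : ℤ) ∣ m) :
    ∃ (x : ℕ) (y : ℤ), (x : ℤ) * m + y * p = 1 ∧ ¬ p ∣ x := by
  have hp' : Prime (p : ℤ) := Nat.prime_iff_prime_int.1 hp
  obtain ⟨v, u, huv⟩ := (hp'.coprime_iff_not_dvd).2 hm
  have hx := Int.toNat_of_nonneg (Int.emod_nonneg u hp'.ne_zero)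
  have hxy : ((u % p).toNat : ℤ) * m + (v + u / p * m) * p = 1 := by
    rw [hx]
    linear_combination huv + m * Int.emod_add_mul_ediv u p
  refine ⟨_, _, hxy, fun ⟨k, hk⟩ => hp'.not_isUnit (isUnit_of_dvd_one ?_)⟩
  exact ⟨k * m + (v + u / p * m), by rw [← hxy, hk]; push_cast; ring⟩

/-- The value of `g ϖ - ϖ` for a nontrivial automorphism `g` of the extension by a `p`-th root of a
`p`-primitive element `a`, where `n` is the order of `a - 1` and the uniformizer `ϖ` of the
extension has the value `ε`. -/
def kummerBreak (p : ℕ) (n : ℤ) (ε : ℝ) : ℝ := 1 / ((p : ℝ) - 1) - (n - 1) * ε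

theorem mul_kummerBreak {p : ℕ} (hp : p.Prime) (n : ℤ) (ε : ℝ) :
    p * kummerBreak p n (ε / p) = kummerBreak p n ε + 1 := by
  have hp0 : (p : ℝ) ≠ 0 := by exact_mod_cast hp.ne_zero
  have hp1 : (p : ℝ) - 1 ≠ 0 := sub_ne_zero.2 (by exact_mod_cast hp.ne_one)
  rw [kummerBreak, kummerBreak]
  field_simp
  ring

theorem isPrimitiveRoot_map_div {F N : Type*} [Field F] [Field N] [Algebra F N] {p : ℕ}
    (hp : p.Prime) {b : N} {g : N ≃ₐ[F] N} (hg : g (b ^ p) = b ^ p) (hgb : g b ≠ b) :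
    IsPrimitiveRoot (g b / b) p := by
  have hb0 : b ≠ 0 := by
    rintro rfl
    exact hgb (map_zero g)
  refine isPrimitiveRoot_of_pow_prime_eq_one hp ?_ (by rwa [Ne, div_eq_one_iff_eq hb0])
  rw [div_pow, ← map_pow, hg, div_self (pow_ne_zero p hb0)]

theorem valuation_map_div_sub_one {F N : Type*} [Field F] [Field N] [Algebra F N]
    {w : AddValuation N (WithTop ℝ)} {p : ℕ} (hp : p.Prime) (hwp : w (p : N) = 1) {b : N}
    {g : N ≃ₐ[F] N} (hg : g (b ^ p) = b ^ p) (hgb : g b ≠ b) {z : N} {r : ℝ}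
    (hz : w z = w b + (r : WithTop ℝ)) (hgz : g z - z = g b - b) :
    w (g z / z - 1) = ((1 / ((p : ℝ) - 1) - r : ℝ) : WithTop ℝ) := by
  have hb0 : b ≠ 0 := by
    rintro rfl
    exact hgb (map_zero g)
  obtain ⟨s, hs⟩ := exists_valuation_eq_coe w hb0
  have hz0 : z ≠ 0 := by
    rintro rfl
    rw [w.map_zero, hs] at hz
    exact WithTop.top_ne_coe hz
  have hζ : IsPrimitiveRoot (g b / b) p := isPrimitiveRoot_map_div hp hg hgb
  have hmul : g z / z - 1 = (g b / b - 1) * b / z := by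
    rw [sub_one_mul, div_mul_cancel₀ _ hb0, ← hgz]
    field_simp
  rw [hmul, w.map_div, w.map_mul, valuation_isPrimitiveRoot_sub_one hp hwp hζ, hz, hs,
    ← WithTop.coe_add, ← WithTop.coe_add, ← WithTop.LinearOrderedAddCommGroup.coe_sub,
    add_comm s, add_sub_add_right_eq_sub]

namespace IsTotallyRamified

variable {F N : Type*} [Field F] [Field N] [Algebra F N] [FiniteDimensional F N]
  {w : AddValuation N (WithTop ℝ)} {e : ℝ} (h : IsTotallyRamified F N w e)

include h

section Step

variable [IsGalois F N] {π : N}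
  (hπ : w π = ((e / finrank F (⊤ : IntermediateField F N) : ℝ) : WithTop ℝ))
  {M E : IntermediateField F N} {ϖ : N} (hϖE : ϖ ∈ E)
  (hϖ : w ϖ = ((e / finrank F E : ℝ) : WithTop ℝ)) {j₀ : ℝ}
  (hj₀ : ∀ g ∈ M.fixingSubgroup, g ∉ E.fixingSubgroup → w (g ϖ - ϖ) = j₀)

include hπ hϖE hϖ hj₀

theorem finsum_ramFun_eq {g : N ≃ₐ[F] N} (hg : g ∈ M.fixingSubgroup)
    (hg' : g ∉ E.fixingSubgroup) :
    ∑ᶠ x : E.fixingSubgroup, ramFun w π (g * (x : N ≃ₐ[F] N)) = j₀ := by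
  rw [← WithTop.coe_inj, ← h.map_sub_eq_finsum hπ hϖE hϖ hg', hj₀ g hg hg']

theorem herbrandSum_fixingSubgroup_eq (hME : M ≤ E) {d : ℕ}
    (hd : finrank F E = d * finrank F M) (s : ℝ) :
    herbrandSum (ramFun w π) M.fixingSubgroup s = herbrandSum (ramFun w π) E.fixingSubgroup s +
      ((d : ℝ) - 1) * min j₀ (herbrandSum (ramFun w π) E.fixingSubgroup s) := by
  have hle : E.fixingSubgroup ≤ M.fixingSubgroup := IntermediateField.fixingSubgroup_le hME
  have hindex : E.fixingSubgroup.relIndex M.fixingSubgroup = d := by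
    refine Nat.eq_of_mul_eq_mul_right (finrank_pos (R := F) (M := M)) ?_
    rw [← hd, IntermediateField.finrank_eq_fixingSubgroup_index,
      IntermediateField.finrank_eq_fixingSubgroup_index, Subgroup.relIndex_mul_index hle]
  rw [(h.isRamFun hπ).herbrandSum_step hle (fun g => h.finsum_ramFun_eq hπ hϖE hϖ hj₀), hindex]

theorem herbrandSum_ramFun_le {g : N ≃ₐ[F] N} (hg : g ∈ M.fixingSubgroup)
    (hg' : g ∉ E.fixingSubgroup) :
    herbrandSum (ramFun w π) E.fixingSubgroup (ramFun w π g) ≤ j₀ :=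
  h.finsum_ramFun_eq hπ hϖE hϖ hj₀ hg hg' ▸ (h.isRamFun hπ).herbrandSum_le_finsum_coset _ hg'

theorem exists_herbrandSum_ramFun_eq (hME : M < E) :
    ∃ g ∈ M.fixingSubgroup, g ∉ E.fixingSubgroup ∧
      herbrandSum (ramFun w π) E.fixingSubgroup (ramFun w π g) = j₀ := by
  obtain ⟨g, hg, hg'⟩ : ∃ g ∈ M.fixingSubgroup, g ∉ E.fixingSubgroup := by
    refine SetLike.not_le_iff_exists.1 fun hle => hME.not_ge ?_
    rwa [← IntermediateField.le_iff_le, IsGalois.fixedField_fixingSubgroup] at hle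
  obtain ⟨x, hx, -, heq⟩ := (h.isRamFun hπ).exists_finsum_coset_eq_herbrandSum _ hg'
  refine ⟨g * x, mul_mem hg (IntermediateField.fixingSubgroup_le hME.le hx),
    fun hgx => hg' ((Subgroup.mul_mem_cancel_right _ hx).1 hgx), ?_⟩
  rw [← heq, h.finsum_ramFun_eq hπ hϖE hϖ hj₀ hg hg']

end Step

section Root

variable {p : ℕ} {M : IntermediateField F N} {b : N}

theorem finrank_sup_adjoin_root_of_not_dvd (hp : p.Prime) (hb : b ^ p ∈ M) {z : N}
    (hz : z ∈ M ⊔ F⟮b⟯) {m : ℤ} (hm : ¬ (p : ℤ) ∣ m)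
    (hwz : w z = ((m * (e / finrank F M / p) : ℝ) : WithTop ℝ)) :
    finrank F ↥(M ⊔ F⟮b⟯) = p * finrank F M := by
  have hz0 : z ≠ 0 := by
    rintro rfl
    exact WithTop.top_ne_coe (w.map_zero.symm.trans hwz)
  obtain ⟨d, hd0, hdp, hd⟩ := exists_finrank_sup_adjoin_eq_mul (b := b)
    (X_pow_sub_C_ne_zero hp.pos (⟨b ^ p, hb⟩ : M)) (by simp)
  rw [natDegree_X_pow_sub_C] at hdp
  obtain ⟨k, hk⟩ := h.exists_int _ z hz hz0
  have hp0 : (p : ℝ) ≠ 0 := by exact_mod_cast hp.ne_zero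
  have hd0' : (d : ℝ) ≠ 0 := by exact_mod_cast hd0.ne'
  have hM0 : (finrank F M : ℝ) ≠ 0 := by exact_mod_cast finrank_pos.ne'
  have hdvd : (m : ℝ) * d = k * p := by
    rw [hwz, WithTop.coe_inj, hd, Nat.cast_mul] at hk
    have he := h.pos.ne'
    field_simp at hk
    linear_combination hk
  have hpd : (p : ℤ) ∣ m * d := ⟨k, by rw [mul_comm (p : ℤ)]; exact_mod_cast hdvd⟩
  have : p ∣ d := by
    exact_mod_cast ((Nat.prime_iff_prime_int.1 hp).dvd_or_dvd hpd).resolve_left hm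
  rw [hd, hdp.antisymm (Nat.le_of_dvd hd0 this)]

variable (hp : p.Prime) (hwp : w (p : N) = 1) {ζ : N} (hζ : IsPrimitiveRoot ζ p) {n : ℤ}
  (ha : IsPPrimitiveOfOrder w p (e / finrank F M) (b ^ p) n)

include hp hwp hζ ha

theorem exists_mem_order_not_dvd :
    ∃ z ∈ M ⊔ F⟮b⟯, ∃ m : ℤ, ¬ (p : ℤ) ∣ m ∧
      w z = ((m * (e / finrank F M / p) : ℝ) : WithTop ℝ) ∧
      w z = w b + ((n * (e / finrank F M / p) : ℝ) : WithTop ℝ) ∧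
      ∀ g : N ≃ₐ[F] N, g z - z = g b - b := by
  obtain ⟨z, m, hz, hm, hwz, hwzb⟩ := (ha.root hp hwp hζ (h.div_pos M) rfl).exists_order_not_dvd
    (_root_.div_pos (h.div_pos M) (by exact_mod_cast hp.pos))
  refine ⟨z, ?_, m, hm, hwz, hwzb, fun g => ?_⟩
  · rcases hz with rfl | rfl
    exacts [mem_sup_adjoin M _, sub_mem (mem_sup_adjoin M b) (one_mem _)]
  · rcases hz with rfl | rfl
    exacts [rfl, by rw [map_sub, map_one, sub_sub_sub_cancel_right]]

variable (hb : b ^ p ∈ M)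

include hb

theorem finrank_sup_adjoin_root : finrank F ↥(M ⊔ F⟮b⟯) = p * finrank F M := by
  obtain ⟨z, hz, m, hm, hwz, -⟩ := h.exists_mem_order_not_dvd hp hwp hζ ha
  exact h.finrank_sup_adjoin_root_of_not_dvd hp hb hz hm hwz

theorem div_finrank_sup_adjoin_root :
    e / finrank F ↥(M ⊔ F⟮b⟯) = e / finrank F M / p := by
  rw [h.finrank_sup_adjoin_root hp hwp hζ ha hb, Nat.cast_mul, mul_comm, div_div]

theorem isPPrimitiveOfOrder_root :
    IsPPrimitiveOfOrder w p (e / finrank F ↥(M ⊔ F⟮b⟯)) b n := by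
  rw [h.div_finrank_sup_adjoin_root hp hwp hζ ha hb]
  exact ha.root hp hwp hζ (h.div_pos M) rfl

theorem exists_uniformizer_map_sub_eq :
    ∃ ϖ ∈ M ⊔ F⟮b⟯, w ϖ = ((e / finrank F ↥(M ⊔ F⟮b⟯) : ℝ) : WithTop ℝ) ∧
      ∀ g ∈ M.fixingSubgroup, g ∉ (M ⊔ F⟮b⟯).fixingSubgroup →
        w (g ϖ - ϖ) = (kummerBreak p n (e / finrank F ↥(M ⊔ F⟮b⟯)) : WithTop ℝ) := by
  rw [h.div_finrank_sup_adjoin_root hp hwp hζ ha hb]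
  obtain ⟨z, hz, m, hm, hwz, hwzb, hgz⟩ := h.exists_mem_order_not_dvd hp hwp hζ ha
  obtain ⟨x, y, hxy, hpx⟩ := exists_nat_mul_add_int_mul_eq_one hp hm
  obtain ⟨u, huM, hu⟩ := h.exists_uniformizer M
  have hp0 : (p : ℝ) ≠ 0 := by exact_mod_cast hp.ne_zero
  have hval : w (z ^ x * u ^ y) = ((e / finrank F M / p : ℝ) : WithTop ℝ) := by
    rw [w.map_mul, valuation_pow_of_eq_coe w hwz, valuation_zpow_of_eq_coe w hu,
      ← WithTop.coe_add, WithTop.coe_inj]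
    have hxy' : (x : ℝ) * m + y * p = 1 := by exact_mod_cast hxy
    have hM0 : (finrank F M : ℝ) ≠ 0 := by exact_mod_cast finrank_pos.ne'
    field_simp
    linear_combination e * hxy'
  have hM : M ≤ M ⊔ F⟮b⟯ := le_sup_left
  refine ⟨_, mul_mem (pow_mem hz x) (zpow_mem (hM huM) y), hval, fun g hg hg' => ?_⟩
  have hgM := (IntermediateField.mem_fixingSubgroup_iff M g).1 hg
  have hgb : g b ≠ b := fun hgb => hg' (mem_fixingSubgroup_sup_adjoin.2 ⟨hg, hgb⟩)
  have hz0 : z ≠ 0 := by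
    rintro rfl
    exact WithTop.top_ne_coe (w.map_zero.symm.trans hwz)
  have hmul : g (z ^ x * u ^ y) - z ^ x * u ^ y = z ^ x * u ^ y * ((g z / z) ^ x - 1) := by
    rw [map_mul, map_pow, map_zpow₀, hgM u huM, mul_sub_one, div_pow, mul_right_comm,
      mul_div_cancel₀ _ (pow_ne_zero x hz0)]
  have hdiv := valuation_map_div_sub_one hp hwp (hgM _ hb) hgb hwzb (hgz g)
  have hpos : 0 < w (g z / z - 1) := by
    have hp1 : (1 : ℝ) < p := by exact_mod_cast hp.one_lt
    rw [hdiv, ← WithTop.coe_zero, WithTop.coe_lt_coe, sub_pos, mul_div_assoc',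
      div_lt_iff₀ (by linarith), one_div_mul_eq_div]
    exact ha.mul_lt hp
  rw [hmul, w.map_mul, hval, valuation_pow_sub_one hp (hwp ▸ zero_lt_one) hpos hpx, hdiv,
    ← WithTop.coe_add, WithTop.coe_inj, kummerBreak]
  ring

variable [IsGalois F N] {π : N}
  (hπ : w π = ((e / finrank F (⊤ : IntermediateField F N) : ℝ) : WithTop ℝ))

include hπ

theorem herbrandSum_sub_kummerBreak_root {s : ℝ}
    (hs : kummerBreak p n (e / finrank F ↥(M ⊔ F⟮b⟯)) ≤
      herbrandSum (ramFun w π) (M ⊔ F⟮b⟯).fixingSubgroup s) :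
    herbrandSum (ramFun w π) M.fixingSubgroup s - kummerBreak p n (e / finrank F M) =
      herbrandSum (ramFun w π) (M ⊔ F⟮b⟯).fixingSubgroup s -
        kummerBreak p n (e / finrank F ↥(M ⊔ F⟮b⟯)) + 1 := by
  obtain ⟨ϖ, hϖE, hϖ, hj₀⟩ := h.exists_uniformizer_map_sub_eq hp hwp hζ ha hb
  rw [h.herbrandSum_fixingSubgroup_eq hπ hϖE hϖ hj₀ le_sup_left
    (h.finrank_sup_adjoin_root hp hwp hζ ha hb), min_eq_left hs]
  rw [h.div_finrank_sup_adjoin_root hp hwp hζ ha hb]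
  linear_combination mul_kummerBreak hp n (e / finrank F M)

theorem herbrandSum_ramFun_le_kummerBreak_root {g : N ≃ₐ[F] N} (hg : g ∈ M.fixingSubgroup)
    (hg' : g ∉ (M ⊔ F⟮b⟯).fixingSubgroup) :
    herbrandSum (ramFun w π) (M ⊔ F⟮b⟯).fixingSubgroup (ramFun w π g) ≤
      kummerBreak p n (e / finrank F ↥(M ⊔ F⟮b⟯)) := by
  obtain ⟨ϖ, hϖE, hϖ, hj₀⟩ := h.exists_uniformizer_map_sub_eq hp hwp hζ ha hb
  exact h.herbrandSum_ramFun_le hπ hϖE hϖ hj₀ hg hg'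

theorem exists_herbrandSum_ramFun_eq_kummerBreak_root :
    ∃ g ∈ M.fixingSubgroup, g ∉ (M ⊔ F⟮b⟯).fixingSubgroup ∧
      herbrandSum (ramFun w π) (M ⊔ F⟮b⟯).fixingSubgroup (ramFun w π g) =
        kummerBreak p n (e / finrank F ↥(M ⊔ F⟮b⟯)) := by
  obtain ⟨ϖ, hϖE, hϖ, hj₀⟩ := h.exists_uniformizer_map_sub_eq hp hwp hζ ha hb
  refine h.exists_herbrandSum_ramFun_eq hπ hϖE hϖ hj₀ (lt_of_le_of_ne le_sup_left fun hME => ?_)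
  have hrank := h.finrank_sup_adjoin_root hp hwp hζ ha hb
  rw [← hME] at hrank
  have hpos := finrank_pos (R := F) (M := M)
  nlinarith [hp.one_lt]

end Root

section Tower

variable {p : ℕ} (hp : p.Prime) (hwp : w (p : N) = 1) {ζ : N} (hζ : IsPrimitiveRoot ζ p)
  {M : IntermediateField F N} {n : ℤ} {c : ℕ} {b : N} (hb : b ^ p ^ c ∈ M)
  (ha : IsPPrimitiveOfOrder w p (e / finrank F M) (b ^ p ^ c) n)

include hp hwp hζ hb ha

theorem finrank_and_isPPrimitiveOfOrder_root_pow :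
    finrank F ↥(M ⊔ F⟮b⟯) = p ^ c * finrank F M ∧
      IsPPrimitiveOfOrder w p (e / finrank F ↥(M ⊔ F⟮b⟯)) b n := by
  induction c generalizing b with
  | zero =>
    rw [pow_zero, pow_one] at hb ha
    rw [sup_eq_left.2 (IntermediateField.adjoin_simple_le_iff.2 hb), pow_zero, one_mul]
    exact ⟨rfl, ha⟩
  | succ c ih =>
    rw [pow_succ', pow_mul] at hb ha
    obtain ⟨hrank, hprim⟩ := ih hb ha
    have hbM := mem_sup_adjoin M (b ^ p)
    rw [← sup_adjoin_pow_sup_adjoin M b p, h.finrank_sup_adjoin_root hp hwp hζ hprim hbM, hrank,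
      pow_succ', mul_assoc, ← hrank]
    exact ⟨rfl, h.finrank_sup_adjoin_root hp hwp hζ hprim hbM ▸
      h.isPPrimitiveOfOrder_root hp hwp hζ hprim hbM⟩

variable [IsGalois F N] {π : N}
  (hπ : w π = ((e / finrank F (⊤ : IntermediateField F N) : ℝ) : WithTop ℝ))

include hπ

theorem herbrandSum_sub_kummerBreak {s : ℝ}
    (hs : kummerBreak p n (e / finrank F ↥(M ⊔ F⟮b⟯)) ≤
      herbrandSum (ramFun w π) (M ⊔ F⟮b⟯).fixingSubgroup s) :
    herbrandSum (ramFun w π) M.fixingSubgroup s - kummerBreak p n (e / finrank F M) =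
      herbrandSum (ramFun w π) (M ⊔ F⟮b⟯).fixingSubgroup s -
        kummerBreak p n (e / finrank F ↥(M ⊔ F⟮b⟯)) + c := by
  induction c generalizing b with
  | zero =>
    rw [pow_zero, pow_one] at hb
    rw [sup_eq_left.2 (IntermediateField.adjoin_simple_le_iff.2 hb), Nat.cast_zero, add_zero]
  | succ c ih =>
    rw [pow_succ', pow_mul] at hb ha
    have hprim := (h.finrank_and_isPPrimitiveOfOrder_root_pow hp hwp hζ hb ha).2
    rw [← sup_adjoin_pow_sup_adjoin M b p] at hs ⊢
    have hroot := h.herbrandSum_sub_kummerBreak_root hp hwp hζ hprim (mem_sup_adjoin M _) hπ hs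
    rw [ih hb ha (by linarith), hroot, Nat.cast_succ, add_assoc, add_comm 1]

theorem herbrandSum_ramFun_le_kummerBreak {g : N ≃ₐ[F] N} (hg : g ∈ M.fixingSubgroup)
    (hg' : g ∉ (M ⊔ F⟮b⟯).fixingSubgroup) :
    herbrandSum (ramFun w π) (M ⊔ F⟮b⟯).fixingSubgroup (ramFun w π g) ≤
      kummerBreak p n (e / finrank F ↥(M ⊔ F⟮b⟯)) := by
  induction c generalizing b with
  | zero =>
    rw [pow_zero, pow_one] at hb
    exact absurd hg (by rwa [sup_eq_left.2 (IntermediateField.adjoin_simple_le_iff.2 hb)] at hg')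
  | succ c ih =>
    rw [pow_succ', pow_mul] at hb ha
    have hprim := (h.finrank_and_isPPrimitiveOfOrder_root_pow hp hwp hζ hb ha).2
    have hbM := mem_sup_adjoin M (b ^ p)
    rw [← sup_adjoin_pow_sup_adjoin M b p] at hg' ⊢
    by_cases hgE : g ∈ (M ⊔ F⟮b ^ p⟯).fixingSubgroup
    · exact h.herbrandSum_ramFun_le_kummerBreak_root hp hwp hζ hprim hbM hπ hgE hg'
    · by_contra! hlt
      have hroot := h.herbrandSum_sub_kummerBreak_root hp hwp hζ hprim hbM hπ hlt.le
      linarith [ih hb ha hgE]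

theorem exists_isGreatest_ramFun (hc : 1 ≤ c) :
    ∃ t, IsGreatest (ramFun w π '' ((M.fixingSubgroup : Set (N ≃ₐ[F] N)) \
        (M ⊔ F⟮b⟯).fixingSubgroup)) t ∧
      herbrandSum (ramFun w π) (M ⊔ F⟮b⟯).fixingSubgroup t =
        kummerBreak p n (e / finrank F ↥(M ⊔ F⟮b⟯)) := by
  obtain ⟨c, rfl⟩ := Nat.exists_eq_add_of_le' hc
  have hle (g : N ≃ₐ[F] N) := h.herbrandSum_ramFun_le_kummerBreak hp hwp hζ hb ha hπ (g := g)
  rw [pow_succ', pow_mul] at hb ha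
  have hprim := (h.finrank_and_isPPrimitiveOfOrder_root_pow hp hwp hζ hb ha).2
  obtain ⟨g, hgM, hgE, hg⟩ := h.exists_herbrandSum_ramFun_eq_kummerBreak_root hp hwp hζ hprim
    (mem_sup_adjoin M _) hπ
  rw [sup_adjoin_pow_sup_adjoin] at hgE hg
  refine ⟨ramFun w π g, ⟨⟨g, ⟨IntermediateField.fixingSubgroup_le le_sup_left hgM, hgE⟩, rfl⟩, ?_⟩,
    hg⟩
  rintro _ ⟨g', ⟨hg'M, hg'E⟩, rfl⟩
  rw [← (herbrandSum_strictMono (j := ramFun w π) (M ⊔ F⟮b⟯).fixingSubgroup).le_iff_le, hg]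
  exact hle g' hg'M hg'E

end Tower

end IsTotallyRamified

end KummerTower

section CyclotomicTower

open Module Polynomial

open scoped IntermediateField

theorem kummerBreak_one (p : ℕ) (ε : ℝ) : kummerBreak p 1 ε = 1 / ((p : ℝ) - 1) := by
  simp [kummerBreak]

theorem adjoin_pow_sup_adjoin (F : Type*) {N : Type*} [Field F] [Field N] [Algebra F N] (b : N)
    (n : ℕ) : F⟮b ^ n⟯ ⊔ F⟮b⟯ = F⟮b⟯ := by
  simpa only [bot_sup_eq] using sup_adjoin_pow_sup_adjoin (⊥ : IntermediateField F N) b n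

theorem map_ne_of_notMem_fixingSubgroup_adjoin {F N : Type*} [Field F] [Field N] [Algebra F N]
    {b : N} {g : N ≃ₐ[F] N} (hg : g ∉ F⟮b⟯.fixingSubgroup) : g b ≠ b := by
  rw [← bot_sup_eq F⟮b⟯, mem_fixingSubgroup_sup_adjoin, IntermediateField.fixingSubgroup_bot] at hg
  exact fun hgb => hg ⟨trivial, hgb⟩

theorem valuation_map_sub_of_isPrimitiveRoot {F N : Type*} [Field F] [Field N] [Algebra F N]
    {w : AddValuation N (WithTop ℝ)} {p : ℕ} (hp : p.Prime) (hwp : w (p : N) = 1) {ξ : N}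
    (hξ : IsPrimitiveRoot ξ p) {g : N ≃ₐ[F] N} (hg : g ξ ≠ ξ) :
    w (g (ξ - 1) - (ξ - 1)) = ((1 / ((p : ℝ) - 1) : ℝ) : WithTop ℝ) := by
  have hξ0 : ξ ≠ 0 := hξ.ne_zero hp.ne_zero
  have hζ : IsPrimitiveRoot (g ξ / ξ) p :=
    isPrimitiveRoot_map_div hp (by rw [hξ.pow_eq_one, map_one]) hg
  have hsub : g (ξ - 1) - (ξ - 1) = (g ξ / ξ - 1) * ξ := by
    rw [map_sub, map_one, sub_sub_sub_cancel_right, sub_one_mul, div_mul_cancel₀ _ hξ0]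
  rw [hsub, w.map_mul, valuation_isPrimitiveRoot_sub_one hp hwp hζ,
    valuation_isPrimitiveRoot hp.ne_zero hξ, add_zero]

namespace IsTotallyRamified

variable {F N : Type*} [Field F] [Field N] [Algebra F N] [FiniteDimensional F N]
  {w : AddValuation N (WithTop ℝ)} (h : IsTotallyRamified F N w 1)
  {p : ℕ} (hp : p.Prime) (hwp : w (p : N) = 1)

include h hp hwp

section PrimeOrder

variable {ξ : N} (hξ : IsPrimitiveRoot ξ p)

include hξ

theorem finrank_adjoin_isPrimitiveRoot_prime : finrank F F⟮ξ⟯ = p - 1 := by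
  have hmem : ξ ∈ F⟮ξ⟯ := IntermediateField.mem_adjoin_simple_self F ξ
  have hint : IsIntegral F ξ := .of_finite F ξ
  have hle : finrank F F⟮ξ⟯ ≤ p - 1 := by
    rw [IntermediateField.adjoin.finrank hint, ← Nat.totient_prime hp, ← natDegree_cyclotomic p F]
    refine natDegree_le_of_dvd (minpoly.dvd F ξ ?_) (cyclotomic_ne_zero p F)
    rw [aeval_def, eval₂_eq_eval_map, map_cyclotomic]
    exact hξ.isRoot_cyclotomic hp.pos
  obtain ⟨z, hz⟩ := h.exists_int F⟮ξ⟯ (ξ - 1) (sub_mem hmem (one_mem _))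
    (sub_ne_zero.2 (hξ.ne_one hp.one_lt))
  have hpos : 0 < finrank F F⟮ξ⟯ := finrank_pos
  have hdvd : ((p - 1 : ℕ) : ℤ) ∣ finrank F F⟮ξ⟯ := by
    refine ⟨z, ?_⟩
    have hp1 : ((p - 1 : ℕ) : ℝ) ≠ 0 := by exact_mod_cast (Nat.sub_pos_of_lt hp.one_lt).ne'
    rw [valuation_isPrimitiveRoot_sub_one hp hwp hξ, WithTop.coe_inj, ← Nat.cast_pred hp.pos] at hz
    have : (finrank F F⟮ξ⟯ : ℝ) = (p - 1 : ℕ) * z := by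
      field_simp at hz
      exact hz
    exact_mod_cast this
  exact hle.antisymm (Nat.le_of_dvd hpos (by exact_mod_cast hdvd))

theorem one_div_finrank_adjoin_isPrimitiveRoot_prime :
    (1 : ℝ) / finrank F F⟮ξ⟯ = 1 / ((p : ℝ) - 1) := by
  rw [h.finrank_adjoin_isPrimitiveRoot_prime hp hwp hξ, Nat.cast_pred hp.pos]

theorem valuation_sub_one_eq_div_finrank :
    w (ξ - 1) = ((1 / finrank F F⟮ξ⟯ : ℝ) : WithTop ℝ) := by
  rw [h.one_div_finrank_adjoin_isPrimitiveRoot_prime hp hwp hξ,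
    valuation_isPrimitiveRoot_sub_one hp hwp hξ]

theorem isPPrimitiveOfOrder_isPrimitiveRoot_prime :
    IsPPrimitiveOfOrder w p (1 / finrank F F⟮ξ⟯) ξ 1 := by
  have hp1 : (1 : ℝ) < p := by exact_mod_cast hp.one_lt
  rw [h.one_div_finrank_adjoin_isPrimitiveRoot_prime hp hwp hξ]
  refine ⟨?_, .inr ⟨one_pos, ?_, fun hd => hp.one_lt.ne' ?_⟩⟩
  · rw [valuation_isPrimitiveRoot_sub_one hp hwp hξ, Int.cast_one, one_mul]
  · rw [Int.cast_one, one_mul, div_lt_div_iff_of_pos_right (by linarith)]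
    exact hp1
  · exact Nat.dvd_one.1 (by exact_mod_cast hd)

variable [IsGalois F N] {π : N}
  (hπ : w π = ((1 / finrank F (⊤ : IntermediateField F N) : ℝ) : WithTop ℝ))

include hπ

theorem herbrandSum_top_eq_of_isPrimitiveRoot_prime {s : ℝ}
    (hs : 1 / ((p : ℝ) - 1) ≤ herbrandSum (ramFun w π) F⟮ξ⟯.fixingSubgroup s) :
    herbrandSum (ramFun (F := F) w π) ⊤ s =
      herbrandSum (ramFun w π) F⟮ξ⟯.fixingSubgroup s + (1 - 1 / ((p : ℝ) - 1)) := by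
  have hp1 : (p : ℝ) - 1 ≠ 0 := sub_ne_zero.2 (by exact_mod_cast hp.ne_one)
  rw [← IntermediateField.fixingSubgroup_bot, h.herbrandSum_fixingSubgroup_eq hπ
    (sub_mem (IntermediateField.mem_adjoin_simple_self F ξ) (one_mem _))
    (h.valuation_sub_one_eq_div_finrank hp hwp hξ)
    (fun g _ hg => valuation_map_sub_of_isPrimitiveRoot hp hwp hξ
      (map_ne_of_notMem_fixingSubgroup_adjoin hg)) bot_le (d := p - 1)
    (by rw [h.finrank_adjoin_isPrimitiveRoot_prime hp hwp hξ, IntermediateField.finrank_bot,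
      mul_one]), min_eq_left hs, Nat.cast_pred hp.pos]
  field_simp

theorem herbrandSum_ramFun_le_of_isPrimitiveRoot_prime {g : N ≃ₐ[F] N}
    (hg : g ∉ F⟮ξ⟯.fixingSubgroup) :
    herbrandSum (ramFun w π) F⟮ξ⟯.fixingSubgroup (ramFun w π g) ≤ 1 / ((p : ℝ) - 1) :=
  h.herbrandSum_ramFun_le (M := ⊥) hπ
    (sub_mem (IntermediateField.mem_adjoin_simple_self F ξ) (one_mem _))
    (h.valuation_sub_one_eq_div_finrank hp hwp hξ)
    (fun _ _ hg => valuation_map_sub_of_isPrimitiveRoot hp hwp hξ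
      (map_ne_of_notMem_fixingSubgroup_adjoin hg))
    (IntermediateField.fixingSubgroup_bot (F := F) (E := N) ▸ Subgroup.mem_top g) hg

end PrimeOrder

variable {c : ℕ} {ζ : N} (hζ : IsPrimitiveRoot ζ (p ^ (c + 1)))

include hζ

theorem finrank_adjoin_isPrimitiveRoot : finrank F F⟮ζ⟯ = p ^ c * (p - 1) := by
  have hξ : IsPrimitiveRoot (ζ ^ p ^ c) p := hζ.pow (pow_pos hp.pos _) (pow_succ p c)
  rw [← adjoin_pow_sup_adjoin F ζ (p ^ c), (h.finrank_and_isPPrimitiveOfOrder_root_pow hp hwp hξ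
    (IntermediateField.mem_adjoin_simple_self F _)
    (h.isPPrimitiveOfOrder_isPrimitiveRoot_prime hp hwp hξ)).1,
    h.finrank_adjoin_isPrimitiveRoot_prime hp hwp hξ]

variable [IsGalois F N] {π : N}
  (hπ : w π = ((1 / finrank F (⊤ : IntermediateField F N) : ℝ) : WithTop ℝ))

include hπ

theorem herbrandSum_adjoin_pow_eq {s : ℝ}
    (hs : 1 / ((p : ℝ) - 1) ≤ herbrandSum (ramFun w π) F⟮ζ⟯.fixingSubgroup s) :
    herbrandSum (ramFun w π) F⟮ζ ^ p ^ c⟯.fixingSubgroup s =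
      herbrandSum (ramFun w π) F⟮ζ⟯.fixingSubgroup s + c := by
  have hξ : IsPrimitiveRoot (ζ ^ p ^ c) p := hζ.pow (pow_pos hp.pos _) (pow_succ p c)
  have hsub := h.herbrandSum_sub_kummerBreak hp hwp hξ
    (IntermediateField.mem_adjoin_simple_self F _)
    (h.isPPrimitiveOfOrder_isPrimitiveRoot_prime hp hwp hξ) hπ (s := s)
  rw [adjoin_pow_sup_adjoin, kummerBreak_one, kummerBreak_one] at hsub
  linarith [hsub hs]

theorem herbrandSum_top_eq_of_isPrimitiveRoot {s : ℝ}
    (hs : 1 / ((p : ℝ) - 1) ≤ herbrandSum (ramFun w π) F⟮ζ⟯.fixingSubgroup s) :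
    herbrandSum (ramFun (F := F) w π) ⊤ s =
      herbrandSum (ramFun w π) F⟮ζ⟯.fixingSubgroup s + (c + 1 - 1 / ((p : ℝ) - 1)) := by
  have hξ : IsPrimitiveRoot (ζ ^ p ^ c) p := hζ.pow (pow_pos hp.pos _) (pow_succ p c)
  have hpow := h.herbrandSum_adjoin_pow_eq hp hwp hζ hπ hs
  rw [h.herbrandSum_top_eq_of_isPrimitiveRoot_prime hp hwp hξ hπ
    (hpow ▸ le_add_of_le_of_nonneg hs c.cast_nonneg), hpow]
  ring

theorem herbrandSum_ramFun_le_of_isPrimitiveRoot {g : N ≃ₐ[F] N}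
    (hg : g ∉ F⟮ζ⟯.fixingSubgroup) :
    herbrandSum (ramFun w π) F⟮ζ⟯.fixingSubgroup (ramFun w π g) ≤ 1 / ((p : ℝ) - 1) := by
  have hξ : IsPrimitiveRoot (ζ ^ p ^ c) p := hζ.pow (pow_pos hp.pos _) (pow_succ p c)
  by_cases hgξ : g ∈ F⟮ζ ^ p ^ c⟯.fixingSubgroup
  · rw [← adjoin_pow_sup_adjoin F ζ (p ^ c)] at hg ⊢
    refine (h.herbrandSum_ramFun_le_kummerBreak hp hwp hξ
      (IntermediateField.mem_adjoin_simple_self F _)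
      (h.isPPrimitiveOfOrder_isPrimitiveRoot_prime hp hwp hξ) hπ hgξ hg).trans_eq ?_
    rw [kummerBreak_one]
  · by_contra! hlt
    have hpow := h.herbrandSum_adjoin_pow_eq hp hwp hζ hπ hlt.le
    have hle := h.herbrandSum_ramFun_le_of_isPrimitiveRoot_prime hp hwp hξ hπ hgξ
    linarith [c.cast_nonneg (α := ℝ)]

theorem exists_isGreatest_ramFun_of_isPrimitiveRoot (hc : 1 ≤ c) :
    ∃ t, IsGreatest (ramFun w π '' (F⟮ζ⟯.fixingSubgroup : Set (N ≃ₐ[F] N))ᶜ) t ∧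
      herbrandSum (ramFun w π) F⟮ζ⟯.fixingSubgroup t = 1 / ((p : ℝ) - 1) := by
  have hξ : IsPrimitiveRoot (ζ ^ p ^ c) p := hζ.pow (pow_pos hp.pos _) (pow_succ p c)
  obtain ⟨t, ⟨⟨g, ⟨-, hg⟩, hgt⟩, -⟩, ht⟩ := h.exists_isGreatest_ramFun hp hwp hξ
    (IntermediateField.mem_adjoin_simple_self F _)
    (h.isPPrimitiveOfOrder_isPrimitiveRoot_prime hp hwp hξ) hπ hc
  rw [adjoin_pow_sup_adjoin] at hg ht
  rw [kummerBreak_one] at ht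
  refine ⟨t, ⟨⟨g, hg, hgt⟩, ?_⟩, ht⟩
  rintro _ ⟨g', hg', rfl⟩
  rw [← (herbrandSum_strictMono (j := ramFun w π) F⟮ζ⟯.fixingSubgroup).le_iff_le, ht]
  exact h.herbrandSum_ramFun_le_of_isPrimitiveRoot hp hwp hζ hπ hg'

end IsTotallyRamified

end CyclotomicTower

section NormalClosure

open Module Polynomial

open scoped IntermediateField

variable {F N : Type*} [Field F] [Field N] [Algebra F N]

theorem minpoly_eq_X_pow_sub_C_of_finrank [FiniteDimensional F N] {M : IntermediateField F N}
    {b : N} {m : ℕ} (hm : 0 < m) (hb : b ^ m ∈ M)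
    (hfinrank : finrank F ↥(M ⊔ F⟮b⟯) = m * finrank F M) :
    minpoly M b = X ^ m - C ⟨b ^ m, hb⟩ := by
  have hint : IsIntegral M b := .of_finite M b
  have hdeg : (minpoly M b).natDegree = m := by
    rw [← IntermediateField.restrictScalars_adjoin_eq_sup, mul_comm] at hfinrank
    rw [← IntermediateField.adjoin.finrank hint]
    exact Nat.eq_of_mul_eq_mul_left finrank_pos ((finrank_mul_finrank F M M⟮b⟯).trans hfinrank)
  refine (eq_of_monic_of_dvd_of_natDegree_le (minpoly.monic hint) (monic_X_pow_sub_C _ hm.ne')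
    (minpoly.dvd M b ?_) ?_).symm
  · simp only [map_sub, map_pow, aeval_X, aeval_C]
    exact sub_self _
  · rw [natDegree_X_pow_sub_C, hdeg]

theorem mem_of_minpoly_eq_X_pow_sub_C {M : IntermediateField F N} {b : N} {m : ℕ} {a : M}
    (hmin : minpoly M b = X ^ m - C a) (hb : b ^ m = a) (hb₀ : b ≠ 0) {ξ : N} (hξ : ξ ^ m = 1)
    {E : IntermediateField F N} [Normal F E] (hbE : b ∈ E) : ξ ∈ E := by
  have hroot : aeval (ξ * b) (minpoly F b) = 0 := by
    rw [← aeval_map_algebraMap M]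
    refine aeval_eq_zero_of_dvd_aeval_eq_zero (minpoly.dvd_map_of_isScalarTower F M b) ?_
    simp only [hmin, map_sub, map_pow, aeval_X, aeval_C, mul_pow, hξ, one_mul, hb]
    exact sub_self _
  have hint : IsIntegral F (⟨b, hbE⟩ : E) := Normal.isIntegral inferInstance _
  have hmin' : minpoly F (⟨b, hbE⟩ : E) = minpoly F b :=
    minpoly.algebraMap_eq (B := E) (B' := N) Subtype.val_injective ⟨b, hbE⟩ |>.symm
  have hsplits := Normal.splits (F := F) inferInstance (⟨b, hbE⟩ : E)
  rw [hmin'] at hsplits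
  obtain ⟨x, hx⟩ := hsplits.mem_range_of_isRoot (f := (minpoly F b).map (algebraMap F E))
    (i := algebraMap E N) (map_ne_zero (hmin' ▸ minpoly.ne_zero hint)) (x := ξ * b) (by
      rwa [map_map, ← IsScalarTower.algebraMap_eq, IsRoot.def, eval_map_algebraMap])
  have hmem : ξ * b ∈ E := hx ▸ x.2
  simpa [hb₀] using div_mem hmem hbE

theorem normalCore_fixingSubgroup_eq_bot [FiniteDimensional F N] [IsGalois F N]
    {E : IntermediateField F N}
    (hE : ∀ X : IntermediateField F N, Normal F X → E ≤ X → X = ⊤) :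
    E.fixingSubgroup.normalCore = ⊥ := by
  have hX := hE (IntermediateField.fixedField E.fixingSubgroup.normalCore)
    (IsGalois.of_fixedField_normal_subgroup _).to_normal
    (IntermediateField.le_iff_le _ _ |>.2 (Subgroup.normalCore_le _))
  rw [← IntermediateField.fixingSubgroup_fixedField E.fixingSubgroup.normalCore, hX,
    IntermediateField.fixingSubgroup_top]

end NormalClosure

section KummerConductor

open Module IsLocalRing

open scoped IntermediateField

section Primitive

variable {N : Type*} [Field N] {w : AddValuation N (WithTop ℝ)} {p : ℕ} {ε : ℝ} {a : N} {n : ℤ}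
  (ha : IsPPrimitiveOfOrder w p ε a n)

include ha

theorem IsPPrimitiveOfOrder.map {E : Type*} [Field E] {w' : AddValuation E (WithTop ℝ)}
    (f : N →+* E) (hf : ∀ x, w' (f x) = w x) : IsPPrimitiveOfOrder w' p ε (f a) n :=
  ⟨by rw [← map_one f, ← map_sub, hf, ha.map_sub_one], by rw [hf]; exact ha.primitive⟩

theorem IsPPrimitiveOfOrder.ne_zero (hε : 0 < ε) : a ≠ 0 := by
  rintro rfl
  rcases ha.primitive with ⟨m, hm, -⟩ | ⟨hn, -, -⟩
  · rw [w.map_zero] at hm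
    exact WithTop.top_ne_coe hm
  · have hsub := ha.map_sub_one
    rw [zero_sub, w.map_neg, w.map_one, ← WithTop.coe_zero, WithTop.coe_inj] at hsub
    exact (mul_pos (Int.cast_pos.2 hn) hε).ne hsub

theorem IsPPrimitiveOfOrder.lt_kummerBreak_add_one (hp : p.Prime) :
    ε < kummerBreak p n ε + 1 := by
  have hp₁ : (0 : ℝ) < p - 1 := sub_pos.2 (by exact_mod_cast hp.one_lt)
  have hdiv : (p : ℝ) / (p - 1) = 1 + 1 / (p - 1) := by field_simp; ring
  have hn := ha.mul_lt hp
  rw [kummerBreak]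
  linarith

end Primitive

namespace IsTotallyRamified

variable {F N : Type*} [Field F] [Field N] [Algebra F N] [FiniteDimensional F N] [IsGalois F N]
  {w : AddValuation N (WithTop ℝ)} {p : ℕ} (hp : p.Prime) (hwp : w (p : N) = 1) {n : ℤ}

include hp hwp

theorem normalCore_fixingSubgroup_sup_adjoin_eq_bot {e : ℝ} (h : IsTotallyRamified F N w e)
    {M : IntermediateField F N} {b ξ : N} {c : ℕ} (hξ : IsPrimitiveRoot ξ (p ^ c)) (hc : 1 ≤ c)
    (hb : b ^ p ^ c ∈ M) (ha : IsPPrimitiveOfOrder w p (e / finrank F M) (b ^ p ^ c) n)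
    (hgen : ∀ X : IntermediateField F N, Normal F X → M ≤ X → ξ ∈ X → b ∈ X → X = ⊤) :
    (M ⊔ F⟮b⟯).fixingSubgroup.normalCore = ⊥ := by
  have hroot : IsPrimitiveRoot (ξ ^ p ^ (c - 1)) p :=
    hξ.pow (pow_pos hp.pos _) (pow_sub_one_mul (by omega) p).symm
  have hb₀ : b ≠ 0 := ne_zero_of_map (f := powMonoidWithZeroHom (pow_pos hp.pos c).ne')
    (ha.ne_zero (h.div_pos M))
  have hmin := minpoly_eq_X_pow_sub_C_of_finrank (pow_pos hp.pos c) hb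
    (h.finrank_and_isPPrimitiveOfOrder_root_pow hp hwp hroot hb ha).1
  refine normalCore_fixingSubgroup_eq_bot fun X hX hle => ?_
  have hbX : b ∈ X := hle (mem_sup_adjoin M b)
  exact hgen X hX (le_sup_left.trans hle)
    (mem_of_minpoly_eq_X_pow_sub_C hmin rfl hb₀ hξ.pow_eq_one hbX) hbX

theorem exists_isGreatest_ramFun_of_isPrimitiveRoot_of_isPPrimitiveOfOrder
    (h : IsTotallyRamified F N w 1) {π : N}
    (hπ : w π = ((1 / finrank F (⊤ : IntermediateField F N) : ℝ) : WithTop ℝ)) {ζ b : N} {ℓ c : ℕ}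
    (hζ : IsPrimitiveRoot ζ (p ^ (ℓ + 1))) (hc : 1 ≤ c)
    (hb : b ^ p ^ c ∈ F⟮ζ⟯) (ha : IsPPrimitiveOfOrder w p (1 / finrank F F⟮ζ⟯) (b ^ p ^ c) n) :
    ∃ t, IsGreatest
        (ramFun w π '' ((F⟮ζ⟯ ⊔ F⟮b⟯).fixingSubgroup : Set (N ≃ₐ[F] N))ᶜ) t ∧
      herbrandSum (ramFun w π) F⟮ζ⟯.fixingSubgroup t =
        max (1 / ((p : ℝ) - 1)) (kummerBreak p n (1 / finrank F F⟮ζ⟯) + c) := by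
  have hξ : IsPrimitiveRoot (ζ ^ p ^ ℓ) p := hζ.pow (pow_pos hp.pos _) (pow_succ p ℓ)
  obtain ⟨t, htmax, ht⟩ := h.exists_isGreatest_ramFun hp hwp hξ hb ha hπ hc
  have htζ := h.herbrandSum_sub_kummerBreak hp hwp hξ hb ha hπ ht.ge
  rw [ht, sub_self, zero_add, sub_eq_iff_eq_add'] at htζ
  have hle : (F⟮ζ⟯ ⊔ F⟮b⟯).fixingSubgroup ≤ F⟮ζ⟯.fixingSubgroup :=
    IntermediateField.fixingSubgroup_le le_sup_left
  have hcompl : ((F⟮ζ⟯ ⊔ F⟮b⟯).fixingSubgroup : Set (N ≃ₐ[F] N))ᶜ =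
      (F⟮ζ⟯.fixingSubgroup : Set (N ≃ₐ[F] N))ᶜ ∪
        (F⟮ζ⟯.fixingSubgroup : Set (N ≃ₐ[F] N)) \ (F⟮ζ⟯ ⊔ F⟮b⟯).fixingSubgroup := by
    ext g
    simp only [Set.mem_compl_iff, Set.mem_union, Set.mem_sdiff, SetLike.mem_coe]
    exact ⟨fun hg => (em' _).imp_right fun hgζ => ⟨hgζ, hg⟩,
      fun hg hgE => hg.elim (· (hle hgE)) (·.2 hgE)⟩
  rw [hcompl, Set.image_union]
  rcases Nat.eq_zero_or_pos ℓ with rfl | hℓ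
  · have hβ : 1 / ((p : ℝ) - 1) ≤ kummerBreak p n (1 / finrank F F⟮ζ⟯) + c := by
      have hc₁ : (1 : ℝ) ≤ c := by exact_mod_cast hc
      have hlt := ha.lt_kummerBreak_add_one hp
      rw [h.finrank_adjoin_isPrimitiveRoot hp hwp hζ, pow_zero, one_mul, Nat.cast_pred hp.pos]
        at hlt ⊢
      exact hlt.le.trans (add_le_add_right hc₁ _)
    refine ⟨t, ⟨Or.inr htmax.1, ?_⟩, by rw [htζ, max_eq_right hβ]⟩
    rintro _ (⟨g, hg, rfl⟩ | hg)
    · rw [← (herbrandSum_strictMono (j := ramFun w π) F⟮ζ⟯.fixingSubgroup).le_iff_le, htζ]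
      exact (h.herbrandSum_ramFun_le_of_isPrimitiveRoot hp hwp hζ hπ hg).trans hβ
    · exact htmax.2 hg
  · obtain ⟨s, hsmax, hs⟩ := h.exists_isGreatest_ramFun_of_isPrimitiveRoot hp hwp hζ hπ hℓ
    exact ⟨max s t, hsmax.union htmax, by rw [(herbrandSum_mono _).map_max, hs, htζ]⟩

end IsTotallyRamified

section ExtendedValuation

variable (A : Type*) [CommRing A] [IsDomain A] [IsDiscreteValuationRing A]
  [IsAdicComplete (maximalIdeal A) A] [IsAlgClosed (ResidueField A)]
  (K : Type*) [Field K] [Algebra A K] [IsFractionRing A K]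

section

variable {F : Type*} [Field F] [Algebra K F] [Algebra A F] [IsScalarTower A K F]
  [FiniteDimensional K F] [Algebra.IsSeparable K F]

variable (F) in
theorem extVal_natCast {p : ℕ} (hpA : Irreducible (p : A)) : extVal A K F (p : F) = 1 := by
  rw [← extVal_algebraMap_of_irreducible A K F hpA, map_natCast (algebraMap A F)]

theorem exists_isPPrimitiveOfOrder {p : ℕ} (hpA : Irreducible (p : A)) {a : F}
    (ha : IsPPrimitive A F p a) (ha₀ : 0 ≤ ord A F a) :
    ∃ n : ℤ, ord A F (a - 1) = n ∧
      IsPPrimitiveOfOrder (extVal A K F) p (finrank K F : ℝ)⁻¹ a n := by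
  have hpos := inv_finrank_pos K F
  rcases ha with ⟨m, hm, hpm⟩ | ⟨n, e, hn, he, hn0, hne, hpn⟩
  · have hm0 : 0 < m := by
      refine lt_of_le_of_ne ?_ (by rintro rfl; exact hpm (dvd_zero _))
      rw [hm] at ha₀
      exact_mod_cast ha₀
    have hwa := extVal_eq_of_ord_eq A K hm
    have hlt : extVal A K F 1 < extVal A K F a := by
      rw [hwa, AddValuation.map_one, ← WithTop.coe_zero, WithTop.coe_lt_coe]
      exact mul_pos (Int.cast_pos.2 hm0) hpos
    have hsub : extVal A K F (a - 1) =
        ((((0 : ℤ) : ℝ) * (finrank K F : ℝ)⁻¹ : ℝ) : WithTop ℝ) := by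
      rw [AddValuation.map_sub_eq_of_lt_right _ hlt, AddValuation.map_one]
      simp
    exact ⟨0, ord_eq_of_extVal_eq A K hsub, hsub, .inl ⟨m, hwa, hpm, hm0, rfl⟩⟩
  · have heF : e = (finrank K F : ℤ) := by
      have hord := ord_algebraMap_of_irreducible A K F hpA
      rw [map_natCast, he] at hord
      exact_mod_cast hord
    refine ⟨n, hn, extVal_eq_of_ord_eq A K hn, .inr ⟨hn0, ?_, hpn⟩⟩
    rw [← div_eq_mul_inv, div_lt_iff₀ (inv_pos.1 hpos)]
    exact_mod_cast heF ▸ hne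

end

section

variable {F N : Type*} [Field F] [Field N] [Algebra F N] [IsGalois F N] [FiniteDimensional F N]
  [Algebra K F] [Algebra A F] [Algebra K N] [Algebra A N] [IsScalarTower A K N]
  [IsScalarTower K F N] [IsScalarTower A F N] [FiniteDimensional K N] [Algebra.IsSeparable K N]

theorem ramConductor_eq_of_isGreatest {π : N} (hπ : IsUniformizer A N π)
    {H : Subgroup (N ≃ₐ[F] N)} (hH : H.normalCore = ⊥) {t : ℝ}
    (ht : IsGreatest (ramFun (extVal A K N) π '' (H : Set (N ≃ₐ[F] N))ᶜ) t) :
    ramConductor A N F =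
      herbrandSum (ramFun (F := F) (extVal A K N) π) ⊤ t * finrank K F - 1 := by
  have := isDiscreteValuationRing_integralClosure A K N
  have h := isTotallyRamified_extVal A K F N
  have hord (x : N) : extVal A K N x = (ord A N x).map fun n : ℤ =>
      (n : ℝ) * ((finrank K F : ℝ)⁻¹ / finrank F (⊤ : IntermediateField F N)) := by
    rw [extVal_apply, ← finrank_mul_finrank K F N, IntermediateField.finrank_top', Nat.cast_mul,
      mul_inv, div_eq_mul_inv]
  obtain ⟨⟨g, hgH, rfl⟩, hmax⟩ := ht
  have hg : g ≠ 1 := fun hg => hgH (hg ▸ one_mem H)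
  have : Nontrivial (N ≃ₐ[F] N) := ⟨g, 1, hg⟩
  obtain ⟨g₀, hg₀, hg₀max⟩ :=
    (h.isRamFun (IsTotallyRamified.valuation_uniformizer hord hπ)).exists_max_notMem hH
  rw [h.ramConductor_eq hord hπ hg fun g' hg' =>
    (hg₀max g' hg').trans (hmax (Set.mem_image_of_mem _ hg₀)), div_inv_eq_mul]

variable (F) in
theorem ramConductor_eq_of_isPPrimitiveOfOrder {p : ℕ} (hp : p.Prime) (hpA : Irreducible (p : A))
    {n : ℤ} {c : ℕ} (hc : 1 ≤ c) {b ξ : N} (hξ : IsPrimitiveRoot ξ (p ^ c))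
    (hb : b ^ p ^ c ∈ (⊥ : IntermediateField F N))
    (ha : IsPPrimitiveOfOrder (extVal A K N) p (finrank K F : ℝ)⁻¹ (b ^ p ^ c) n)
    (hgen : ∀ X : IntermediateField F N, Normal F X → ξ ∈ X → b ∈ X → X = ⊤) :
    ramConductor A N F = (kummerBreak p n (finrank K F : ℝ)⁻¹ + c) * finrank K F - 1 := by
  have := isDiscreteValuationRing_integralClosure A K N
  obtain ⟨π, hπ⟩ := exists_isUniformizer A N
  have h := isTotallyRamified_extVal A K F N
  have hπ' := extVal_of_isUniformizer A K hπ
  rw [← finrank_mul_finrank K F N, Nat.cast_mul, mul_inv, ← div_eq_mul_inv,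
    ← IntermediateField.finrank_top' (F := F) (E := N)] at hπ'
  have hwp := extVal_natCast A K N hpA
  have hroot : IsPrimitiveRoot (ξ ^ p ^ (c - 1)) p :=
    hξ.pow (pow_pos hp.pos _) (pow_sub_one_mul (by omega) p).symm
  have hbot : (finrank K F : ℝ)⁻¹ / finrank F (⊥ : IntermediateField F N) =
      (finrank K F : ℝ)⁻¹ := by rw [IntermediateField.finrank_bot, Nat.cast_one, div_one]
  rw [← hbot] at ha
  obtain ⟨t, htmax, ht⟩ := h.exists_isGreatest_ramFun hp hwp hroot hb ha hπ' hc
  have htop := h.herbrandSum_sub_kummerBreak hp hwp hroot hb ha hπ' ht.ge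
  rw [ht, sub_self, zero_add, sub_eq_iff_eq_add', hbot] at htop
  rw [IntermediateField.fixingSubgroup_bot] at htmax htop
  rw [Subgroup.coe_top, ← Set.compl_eq_univ_sdiff] at htmax
  rw [ramConductor_eq_of_isGreatest A K hπ (h.normalCore_fixingSubgroup_sup_adjoin_eq_bot hp hwp hξ
    hc hb ha fun X hX _ => hgen X hX) htmax, htop]

end

variable {N : Type*} [Field N] [Algebra K N] [Algebra A N] [IsScalarTower A K N]
  [FiniteDimensional K N] [IsGalois K N]

theorem ramConductor_eq_max_of_isPPrimitiveOfOrder {p : ℕ} (hp : p.Prime)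
    (hpA : Irreducible (p : A)) {n : ℤ} {ℓ c : ℕ} (hc : 1 ≤ c) {ζ b ξ : N}
    (hζ : IsPrimitiveRoot ζ (p ^ (ℓ + 1))) (hξ : IsPrimitiveRoot ξ (p ^ c)) (hb : b ^ p ^ c ∈ K⟮ζ⟯)
    (ha : IsPPrimitiveOfOrder (extVal A K N) p (finrank K K⟮ζ⟯ : ℝ)⁻¹ (b ^ p ^ c) n)
    (hgen : ∀ X : IntermediateField K N, Normal K X → ζ ∈ X → ξ ∈ X → b ∈ X → X = ⊤) :
    ramConductor A N K =
      max (ℓ : ℝ) (c + ℓ - ((n : ℝ) - 1) / ((p : ℝ) ^ ℓ * ((p : ℝ) - 1))) := by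
  have := isDiscreteValuationRing_integralClosure A K N
  obtain ⟨π, hπ⟩ := exists_isUniformizer A N
  have h := isTotallyRamified_extVal A K K N
  rw [finrank_self, Nat.cast_one, inv_one] at h
  have hπ' := extVal_of_isUniformizer A K hπ
  rw [← one_div, ← IntermediateField.finrank_top'] at hπ'
  have hwp := extVal_natCast A K N hpA
  rw [← one_div] at ha
  obtain ⟨t, htmax, ht⟩ := h.exists_isGreatest_ramFun_of_isPrimitiveRoot_of_isPPrimitiveOfOrder
    hp hwp hπ' hζ hc hb ha
  have hcore := h.normalCore_fixingSubgroup_sup_adjoin_eq_bot hp hwp hξ hc hb ha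
    fun X hX hζX => hgen X hX (IntermediateField.adjoin_simple_le_iff.1 hζX)
  rw [ramConductor_eq_of_isGreatest A K hπ hcore htmax,
    h.herbrandSum_top_eq_of_isPrimitiveRoot hp hwp hζ hπ' (ht ▸ le_max_left _ _), ht,
    h.finrank_adjoin_isPrimitiveRoot hp hwp hζ, finrank_self, kummerBreak, Nat.cast_mul,
    Nat.cast_pow, Nat.cast_pred hp.pos, max_add, Nat.cast_one, mul_one, ← max_sub_sub_right]
  congr 1 <;> ring

end ExtendedValuation

end KummerConductor

section WittVector

open IsLocalRing

variable (p : ℕ) [Fact p.Prime] (k : Type*) [Field k] [CharP k p]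

instance charZero_wittVector : CharZero (WittVector p k) := by
  refine charZero_of_inj_zero fun n hn => ?_
  by_contra hn₀
  obtain ⟨e, m, hpm, rfl⟩ := Nat.exists_eq_pow_mul_and_not_dvd hn₀ p (Fact.out : p.Prime).ne_one
  rw [Nat.cast_mul, Nat.cast_pow] at hn
  have hm := (mul_eq_zero.1 hn).resolve_left (pow_ne_zero e (WittVector.irreducible p).ne_zero)
  have hmk : (m : k) = 0 := by
    rw [← map_natCast (WittVector.constantCoeff (p := p)) m, hm, map_zero]
  exact hpm ((CharP.cast_eq_zero_iff k p m).1 hmk)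

variable [IsAlgClosed k]

theorem maximalIdeal_wittVector :
    maximalIdeal (WittVector p k) = Ideal.span {(p : WittVector p k)} :=
  (WittVector.irreducible p).maximalIdeal_eq

instance isAdicComplete_wittVector :
    IsAdicComplete (maximalIdeal (WittVector p k)) (WittVector p k) := by
  rw [maximalIdeal_wittVector]
  infer_instance

instance isAlgClosed_residueField_wittVector : IsAlgClosed (ResidueField (WittVector p k)) :=
  IsAlgClosed.of_ringEquiv k _ ((WittVector.quotientPEquiv (p := p) (k := k)).symm.trans
    (Ideal.quotEquivOfEq (maximalIdeal_wittVector p k).symm))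

end WittVector

section KummerExtension

open Module

open scoped IntermediateField

theorem eq_top_of_le_lift {F Ω : Type*} [Field F] [Field Ω] [Algebra F Ω]
    {E : IntermediateField F Ω} {X : IntermediateField F E} (hX : E ≤ IntermediateField.lift X) :
    X = ⊤ :=
  eq_top_iff.2 fun x _ => (IntermediateField.mem_lift x).1 (hX x.2)

theorem exists_isPrimitiveRoot (p : ℕ) [Fact p.Prime] (K₀ Ω : Type*) [Field K₀] [Field Ω]
    [Algebra K₀ Ω] [CharZero K₀] [IsAlgClosure K₀ Ω] (n : ℕ) :
    ∃ ζ : Ω, IsPrimitiveRoot ζ (p ^ n) := by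
  have := IsAlgClosure.isAlgClosed K₀ (K := Ω)
  have : CharZero Ω := charZero_of_injective_algebraMap (algebraMap K₀ Ω).injective
  exact HasEnoughRootsOfUnity.exists_primitiveRoot Ω (p ^ n)

variable {p : ℕ} {K₀ Ω : Type*} [Field K₀] [Field Ω] [Algebra K₀ Ω]

section

variable [IsAlgClosure K₀ Ω] {ℓ c : ℕ} {b : Ω}

theorem kummerExt_le_kummerClosure :
    (kummerExt p K₀ Ω ℓ c b).restrictScalars K₀ ≤ kummerClosure p K₀ Ω ℓ c b :=
  have := IsAlgClosure.normal K₀ Ω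
  IntermediateField.le_normalClosure _

theorem cyc_le_kummerClosure : cyc p K₀ Ω ℓ ≤ kummerClosure p K₀ Ω ℓ c b := fun x hx =>
  kummerExt_le_kummerClosure ((kummerExt p K₀ Ω ℓ c b).algebraMap_mem ⟨x, hx⟩)

instance isGalois_kummerClosure [CharZero K₀] : IsGalois K₀ (kummerClosure p K₀ Ω ℓ c b) := by
  have := IsAlgClosure.normal K₀ Ω
  have : Normal K₀ (kummerClosure p K₀ Ω ℓ c b) := normalClosure.normal K₀ _ Ω
  exact IsGalois.mk

end

variable [Fact p.Prime]

theorem cyc_eq_adjoin {n : ℕ} {ζ : Ω} (hζ : IsPrimitiveRoot ζ (p ^ n)) :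
    cyc p K₀ Ω n = K₀⟮ζ⟯ := by
  refine le_antisymm (IntermediateField.adjoin_le_iff.2 fun ξ hξ => ?_)
    (IntermediateField.adjoin_simple_le_iff.2 (IntermediateField.subset_adjoin _ _ hζ))
  obtain ⟨i, -, rfl⟩ := hζ.eq_pow_of_pow_eq_one (IsPrimitiveRoot.pow_eq_one hξ)
  exact pow_mem (IntermediateField.mem_adjoin_simple_self K₀ ζ) i

theorem cyc_eq_lift {N : IntermediateField K₀ Ω} {n : ℕ} {ζ : N}
    (hζ : IsPrimitiveRoot ζ (p ^ n)) : cyc p K₀ Ω n = IntermediateField.lift K₀⟮ζ⟯ := by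
  rw [IntermediateField.lift_adjoin_simple,
    cyc_eq_adjoin (IsPrimitiveRoot.coe_submonoidClass_iff.2 hζ)]

theorem finrank_adjoin_eq_finrank_cyc {N : IntermediateField K₀ Ω} {n : ℕ} {ζ : N}
    (hζ : IsPrimitiveRoot ζ (p ^ n)) : finrank K₀ K₀⟮ζ⟯ = finrank K₀ (cyc p K₀ Ω n) := by
  rw [cyc_eq_lift hζ]
  exact (IntermediateField.liftAlgEquiv K₀⟮ζ⟯).toLinearEquiv.finrank_eq

variable [CharZero K₀] [IsAlgClosure K₀ Ω]

theorem cyc_mono : Monotone (cyc p K₀ Ω) := fun m n hmn => by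
  obtain ⟨ζ, hζ⟩ := exists_isPrimitiveRoot p K₀ Ω n
  obtain ⟨d, rfl⟩ := Nat.exists_eq_add_of_le' hmn
  have hζm : IsPrimitiveRoot (ζ ^ p ^ d) (p ^ m) := hζ.pow (NeZero.pos _) (pow_add p d m)
  rw [cyc_eq_adjoin hζm, cyc_eq_adjoin hζ, IntermediateField.adjoin_simple_le_iff]
  exact pow_mem (IntermediateField.mem_adjoin_simple_self K₀ ζ) _

instance finiteDimensional_cyc (n : ℕ) : FiniteDimensional K₀ (cyc p K₀ Ω n) := by
  obtain ⟨ζ, hζ⟩ := exists_isPrimitiveRoot p K₀ Ω n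
  rw [cyc_eq_adjoin hζ]
  exact IntermediateField.adjoin.finiteDimensional
    (IsAlgClosure.isAlgebraic.isIntegral.isIntegral ζ)

variable {ℓ c : ℕ} {b : Ω}

theorem kummerExt_le_iff {ξ : Ω} (hξ : IsPrimitiveRoot ξ (p ^ c))
    {X : IntermediateField (cyc p K₀ Ω ℓ) Ω} :
    kummerExt p K₀ Ω ℓ c b ≤ X ↔ ξ ∈ X ∧ b ∈ X := by
  rw [kummerExt, IntermediateField.adjoin_le_iff, Set.union_subset_iff, Set.singleton_subset_iff]
  refine and_congr_left fun _ => ⟨fun h => ?_, fun h => ?_⟩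
  · exact h (cyc_mono (le_max_right ℓ c) (IntermediateField.subset_adjoin _ _ hξ))
  · change cyc p K₀ Ω (max ℓ c) ≤ X.restrictScalars K₀
    rcases le_total ℓ c with hle | hle
    · rw [max_eq_right hle, cyc_eq_adjoin hξ, IntermediateField.adjoin_simple_le_iff]
      exact h
    · rw [max_eq_left hle]
      exact fun x hx => X.algebraMap_mem ⟨x, hx⟩

theorem kummerExt_eq_adjoin {ξ : Ω} (hξ : IsPrimitiveRoot ξ (p ^ c)) :
    kummerExt p K₀ Ω ℓ c b = IntermediateField.adjoin (cyc p K₀ Ω ℓ) {ξ, b} :=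
  eq_of_forall_ge_iff fun X => by
    rw [kummerExt_le_iff hξ, IntermediateField.adjoin_le_iff, Set.insert_subset_iff,
      Set.singleton_subset_iff, SetLike.mem_coe, SetLike.mem_coe]

theorem mem_kummerExt {ξ : Ω} (hξ : IsPrimitiveRoot ξ (p ^ c)) :
    ξ ∈ kummerExt p K₀ Ω ℓ c b ∧ b ∈ kummerExt p K₀ Ω ℓ c b :=
  (kummerExt_le_iff hξ).1 le_rfl

theorem eq_top_of_mem_of_mem_kummerExt
    {X : IntermediateField (cyc p K₀ Ω ℓ) (kummerExt p K₀ Ω ℓ c b)}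
    {ξ : kummerExt p K₀ Ω ℓ c b} (hξ : IsPrimitiveRoot ξ (p ^ c)) (hξX : ξ ∈ X)
    {hbE : b ∈ kummerExt p K₀ Ω ℓ c b} (hbX : ⟨b, hbE⟩ ∈ X) : X = ⊤ :=
  eq_top_of_le_lift ((kummerExt_le_iff (IsPrimitiveRoot.coe_submonoidClass_iff.2 hξ)).2
    ⟨(IntermediateField.mem_lift ξ).2 hξX, (IntermediateField.mem_lift ⟨b, hbE⟩).2 hbX⟩)

instance finiteDimensional_kummerExt :
    FiniteDimensional (cyc p K₀ Ω ℓ) (kummerExt p K₀ Ω ℓ c b) := by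
  obtain ⟨ξ, hξ⟩ := exists_isPrimitiveRoot p K₀ Ω c
  rw [kummerExt_eq_adjoin hξ]
  exact IntermediateField.finiteDimensional_adjoin fun x _ =>
    ((IsAlgClosure.isAlgebraic (R := K₀) (K := Ω)).isIntegral.isIntegral x).tower_top

theorem isGalois_kummerExt {a : cyc p K₀ Ω ℓ} (hb : b ^ p ^ c = (a : Ω)) :
    IsGalois (cyc p K₀ Ω ℓ) (kummerExt p K₀ Ω ℓ c b) := by
  have := IsAlgClosure.normal K₀ Ω
  have : Normal (cyc p K₀ Ω ℓ) Ω := Normal.tower_top_of_normal K₀ _ Ω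
  obtain ⟨ξ, hξ⟩ := exists_isPrimitiveRoot p K₀ Ω c
  obtain ⟨hξE, hbE⟩ := mem_kummerExt (K₀ := K₀) (ℓ := ℓ) (b := b) hξ
  have hroot {η : Ω} (hη : η ^ p ^ c = 1) : η ∈ kummerExt p K₀ Ω ℓ c b := by
    obtain ⟨i, -, rfl⟩ := hξ.eq_pow_of_pow_eq_one hη
    exact pow_mem hξE i
  have : Normal (cyc p K₀ Ω ℓ) (kummerExt p K₀ Ω ℓ c b) := by
    refine IntermediateField.normal_iff_forall_map_le.2 fun σ => ?_
    rw [IntermediateField.map_le_iff_le_comap, kummerExt_le_iff hξ]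
    refine ⟨hroot (η := σ ξ) (by rw [← map_pow, hξ.pow_eq_one, map_one]), ?_⟩
    change σ b ∈ kummerExt p K₀ Ω ℓ c b
    rcases eq_or_ne b 0 with rfl | hb₀
    · rwa [map_zero]
    have hσb : (σ b / b) ^ p ^ c = 1 := by
      rw [div_pow, ← map_pow, hb, show σ (a : Ω) = a from σ.commutes a, ← hb,
        div_self (pow_ne_zero _ hb₀)]
    simpa only [div_mul_cancel₀ _ hb₀] using mul_mem (hroot hσb) hbE
  exact IsGalois.mk

instance finiteDimensional_kummerClosure :
    FiniteDimensional K₀ (kummerClosure p K₀ Ω ℓ c b) := by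
  have : FiniteDimensional K₀ ((kummerExt p K₀ Ω ℓ c b).restrictScalars K₀) :=
    FiniteDimensional.trans K₀ (cyc p K₀ Ω ℓ) (kummerExt p K₀ Ω ℓ c b)
  exact normalClosure.is_finiteDimensional K₀ _ Ω

theorem eq_top_of_normal_of_mem_kummerClosure
    {X : IntermediateField K₀ (kummerClosure p K₀ Ω ℓ c b)} [Normal K₀ X]
    {ζ ξ : kummerClosure p K₀ Ω ℓ c b} (hζ : IsPrimitiveRoot ζ (p ^ ℓ)) (hζX : ζ ∈ X)
    (hξ : IsPrimitiveRoot ξ (p ^ c)) (hξX : ξ ∈ X)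
    {hbL : b ∈ kummerClosure p K₀ Ω ℓ c b} (hbX : ⟨b, hbL⟩ ∈ X) : X = ⊤ := by
  have := IsAlgClosure.normal K₀ Ω
  have : Normal K₀ (IntermediateField.lift X) :=
    Normal.of_algEquiv (IntermediateField.liftAlgEquiv X)
  have hcyc : cyc p K₀ Ω ℓ ≤ IntermediateField.lift X := by
    rw [cyc_eq_adjoin (IsPrimitiveRoot.coe_submonoidClass_iff.2 hζ),
      IntermediateField.adjoin_simple_le_iff]
    exact (IntermediateField.mem_lift ζ).2 hζX
  have hle : kummerExt p K₀ Ω ℓ c b ≤ IntermediateField.extendScalars hcyc := by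
    rw [kummerExt_le_iff (IsPrimitiveRoot.coe_submonoidClass_iff.2 hξ)]
    exact ⟨(IntermediateField.mem_lift ξ).2 hξX, (IntermediateField.mem_lift ⟨b, hbL⟩).2 hbX⟩
  exact eq_top_of_le_lift (IntermediateField.normalClosure_le_iff_of_normal.2 hle)

end KummerExtension

section Conductor

open Module IsLocalRing

open scoped IntermediateField

variable (A : Type*) [CommRing A] [IsDomain A] [IsDiscreteValuationRing A]
  [IsAdicComplete (maximalIdeal A) A] [IsAlgClosed (ResidueField A)]
  {p : ℕ} [Fact p.Prime] (hpA : Irreducible (p : A))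
  {K₀ Ω : Type*} [Field K₀] [CharZero K₀] [Algebra A K₀] [IsFractionRing A K₀] [Field Ω]
  [Algebra K₀ Ω] [IsAlgClosure K₀ Ω] [Algebra A Ω] [IsScalarTower A K₀ Ω]

include hpA

variable (K₀ Ω) in
theorem finrank_cyc (ℓ : ℕ) : finrank K₀ (cyc p K₀ Ω (ℓ + 1)) = p ^ ℓ * (p - 1) := by
  obtain ⟨ζ, hζ⟩ := exists_isPrimitiveRoot p K₀ Ω (ℓ + 1)
  have hζ' : IsPrimitiveRoot (⟨ζ, IntermediateField.subset_adjoin _ _ hζ⟩ : cyc p K₀ Ω (ℓ + 1))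
      (p ^ (ℓ + 1)) := IsPrimitiveRoot.coe_submonoidClass_iff.1 hζ
  have h := isTotallyRamified_extVal A K₀ K₀ (cyc p K₀ Ω (ℓ + 1))
  rw [finrank_self, Nat.cast_one, inv_one] at h
  rw [← finrank_adjoin_eq_finrank_cyc hζ', h.finrank_adjoin_isPrimitiveRoot Fact.out
    (extVal_natCast A K₀ _ hpA) hζ']

variable {ℓ c : ℕ} (hc : 1 ≤ c) {n : ℤ} {a : cyc p K₀ Ω (ℓ + 1)}
  (ha : IsPPrimitiveOfOrder (extVal A K₀ (cyc p K₀ Ω (ℓ + 1))) p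
    (finrank K₀ (cyc p K₀ Ω (ℓ + 1)) : ℝ)⁻¹ a n)
  {b : Ω} (hb : b ^ p ^ c = (a : Ω))

include hc ha hb

theorem ramConductor_kummerExt :
    ramConductor A (kummerExt p K₀ Ω (ℓ + 1) c b) (cyc p K₀ Ω (ℓ + 1)) =
      ((c : ℝ) * ((p : ℝ) - 1) + 1) * (p : ℝ) ^ ℓ - n := by
  have hp : p.Prime := Fact.out
  have := isGalois_kummerExt hb
  have : FiniteDimensional K₀ (kummerExt p K₀ Ω (ℓ + 1) c b) :=
    FiniteDimensional.trans K₀ (cyc p K₀ Ω (ℓ + 1)) (kummerExt p K₀ Ω (ℓ + 1) c b)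
  have : IsScalarTower A K₀ (kummerExt p K₀ Ω (ℓ + 1) c b) :=
    IsScalarTower.of_algebraMap_eq fun x =>
      Subtype.ext (IsScalarTower.algebraMap_apply A K₀ Ω x)
  obtain ⟨ξ, hξ⟩ := exists_isPrimitiveRoot p K₀ Ω c
  obtain ⟨hξE, hbE⟩ := mem_kummerExt (K₀ := K₀) (ℓ := ℓ + 1) (b := b) hξ
  have hξ' : IsPrimitiveRoot (⟨ξ, hξE⟩ : kummerExt p K₀ Ω (ℓ + 1) c b) (p ^ c) :=
    IsPrimitiveRoot.coe_submonoidClass_iff.1 hξ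
  have hbpow : (⟨b, hbE⟩ : kummerExt p K₀ Ω (ℓ + 1) c b) ^ p ^ c = algebraMap _ _ a :=
    Subtype.ext hb
  rw [ramConductor_eq_of_isPPrimitiveOfOrder A K₀ (cyc p K₀ Ω (ℓ + 1)) hp hpA hc hξ'
    (hbpow ▸ IntermediateField.algebraMap_mem _ a)
    (hbpow ▸ ha.map (algebraMap _ _) fun x => extVal_map A K₀
      (IsScalarTower.toAlgHom A (cyc p K₀ Ω (ℓ + 1)) (kummerExt p K₀ Ω (ℓ + 1) c b)) x)
    (fun X _ hξX hbX => eq_top_of_mem_of_mem_kummerExt hξ' hξX hbX),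
    finrank_cyc A hpA, kummerBreak, Nat.cast_mul, Nat.cast_pow, Nat.cast_pred hp.pos]
  have hp₁ : (0 : ℝ) < p - 1 := sub_pos.2 (by exact_mod_cast hp.one_lt)
  have hp₀ : (0 : ℝ) < p := by exact_mod_cast hp.pos
  field_simp
  ring

theorem ramConductor_kummerClosure :
    ramConductor A (kummerClosure p K₀ Ω (ℓ + 1) c b) K₀ =
      max (ℓ : ℝ) (c + ℓ - ((n : ℝ) - 1) / ((p : ℝ) ^ ℓ * ((p : ℝ) - 1))) := by
  have hcyc : cyc p K₀ Ω (ℓ + 1) ≤ kummerClosure p K₀ Ω (ℓ + 1) c b := cyc_le_kummerClosure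
  obtain ⟨ζ, hζ⟩ := exists_isPrimitiveRoot p K₀ Ω (ℓ + 1)
  obtain ⟨ξ, hξ⟩ := exists_isPrimitiveRoot p K₀ Ω c
  obtain ⟨hξE, hbE⟩ := mem_kummerExt (K₀ := K₀) (ℓ := ℓ + 1) (b := b) hξ
  have hbL : b ∈ kummerClosure p K₀ Ω (ℓ + 1) c b := kummerExt_le_kummerClosure hbE
  have hζ' : IsPrimitiveRoot (⟨ζ, hcyc (IntermediateField.subset_adjoin _ _ hζ)⟩ :
      kummerClosure p K₀ Ω (ℓ + 1) c b) (p ^ (ℓ + 1)) :=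
    IsPrimitiveRoot.coe_submonoidClass_iff.1 hζ
  have hξ' : IsPrimitiveRoot (⟨ξ, kummerExt_le_kummerClosure hξE⟩ :
      kummerClosure p K₀ Ω (ℓ + 1) c b) (p ^ c) := IsPrimitiveRoot.coe_submonoidClass_iff.1 hξ
  have hbpow : (⟨b, hbL⟩ : kummerClosure p K₀ Ω (ℓ + 1) c b) ^ p ^ c =
      IntermediateField.inclusion hcyc a := Subtype.ext hb
  refine ramConductor_eq_max_of_isPPrimitiveOfOrder A K₀ Fact.out hpA hc hζ' hξ' (b := ⟨b, hbL⟩)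
    ?_ ?_ fun X _ hζX hξX hbX => eq_top_of_normal_of_mem_kummerClosure hζ' hζX hξ' hξX hbX
  · rw [hbpow, ← IntermediateField.mem_lift, ← cyc_eq_lift hζ']
    exact a.2
  · rw [finrank_adjoin_eq_finrank_cyc hζ', hbpow]
    exact ha.map (IntermediateField.inclusion hcyc).toRingHom fun x =>
      extVal_map A K₀ ((IntermediateField.inclusion hcyc).restrictScalars A) x

end Conductor

end RamificationConductor

end

open RamificationConductor in
theorem proposition4p2 (p : ℕ) [Fact p.Prime] (k : Type*) [Field k] [CharP k p] [IsAlgClosed k]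
    (K₀ : Type*) [Field K₀] [Algebra (WittVector p k) K₀] [IsFractionRing (WittVector p k) K₀]
    (Ω : Type*) [Field Ω] [Algebra K₀ Ω] [IsAlgClosure K₀ Ω]
    [Algebra (WittVector p k) Ω] [IsScalarTower (WittVector p k) K₀ Ω]
    (ℓ c : ℕ) (hℓ : 1 ≤ ℓ) (hc : 1 ≤ c)
    (a t : cyc p K₀ Ω ℓ) (hat : a = 1 + t)
    (ha : IsPPrimitive (WittVector p k) (cyc p K₀ Ω ℓ) p a)
    (ha₀ : 0 ≤ ord (WittVector p k) (cyc p K₀ Ω ℓ) a)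
    (b : Ω) (hb : b ^ p ^ c = (a : Ω)) :
    ∃ n : ℤ, ord (WittVector p k) (cyc p K₀ Ω ℓ) t = n ∧
      IsGalois (cyc p K₀ Ω ℓ) (kummerExt p K₀ Ω ℓ c b) ∧
      ramConductor (WittVector p k) (kummerExt p K₀ Ω ℓ c b) (cyc p K₀ Ω ℓ) =
        ((c : ℝ) * ((p : ℝ) - 1) + 1) * (p : ℝ) ^ (ℓ - 1) - (n : ℝ) ∧
      ramConductor (WittVector p k) (kummerClosure p K₀ Ω ℓ c b) K₀ =
        max ((ℓ : ℝ) - 1)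
          ((c : ℝ) + (ℓ : ℝ) - 1 - ((n : ℝ) - 1) / ((p : ℝ) ^ (ℓ - 1) * ((p : ℝ) - 1))) := by
  have hpA : Irreducible (p : WittVector p k) := WittVector.irreducible p
  have : CharZero K₀ :=
    charZero_of_injective_algebraMap (IsFractionRing.injective (WittVector p k) K₀)
  have hta : t = a - 1 := by rw [hat, add_sub_cancel_left]
  obtain ⟨ℓ, rfl⟩ := Nat.exists_eq_add_of_le' hℓ
  obtain ⟨n, hn, hprim⟩ := exists_isPPrimitiveOfOrder (WittVector p k) K₀ hpA ha ha₀
  refine ⟨n, hta ▸ hn, isGalois_kummerExt hb, ?_, ?_⟩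
  · rw [ramConductor_kummerExt (WittVector p k) hpA hc hprim hb, Nat.add_sub_cancel]
  · rw [ramConductor_kummerClosure (WittVector p k) hpA hc hprim hb, Nat.add_sub_cancel,
      Nat.cast_add_one, add_sub_cancel_right, ← add_assoc, add_sub_cancel_right]
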